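/- **Setting.** Let $f,g\in C^2(\mathbb R)$, $f(0)=g(0)=0$, $\sigma,\alpha>0$, with $f'(0)+g'(0)<0$ and $f'(0)g'(0)+\sigma\alpha>0$, and consider $$u_t=u_{xx}+f(u)-\sigma v,\qquad v_t=v_{xx}+g(v)+\alpha u .$$ A traveling wave of speed $c$ in the variable $z=x-ct$ is a solution $\varphi=(\hat u,\hat v,\hat w,\hat y)$, decaying exponentially as $z\to\pm\infty$, of $$u'=\sigma w,\quad v'=\alpha y,\quad w'=-cw-\tfrac{f(u)}{\sigma}+v,\quad y'=-cy-u-\tfrac{g(v)}{\alpha}\qquad(*)$$ (so $\hat w=\hat u'/\sigma$, $\hat y=\hat v'/\alpha$). Let $A(\lambda,z)$ be the matrix $$A(\lambda,z)=\begin{pmatrix}0&0&\sigma&0\\0&0&0&\alpha\\ \frac{\lambda-f'(\hat u(z))}{\sigma}&1&-c&0\\-1&\frac{\lambda-g'(\hat v(z))}{\alpha}&0&-c\end{pmatrix},$$ and let $A_\infty(\lambda)$ be the same matrix with $(\hat u,\hat v)=(0,0)$. Assume: 1. $c<0$. 2. The eigenvalues $\nu_1,\nu_2$ of $\begin{pmatrix}f'(0)&-\sigma\\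 \alpha&g'(0)\end{pmatrix}$ are real with $\nu_1<\nu_2<0$. Put $\mu_{1,4}(\lambda)=-\frac c2\mp\frac12\sqrt{c^2+4(\lambda-\nu_1)}$ and $\mu_{2,3}(\lambda)=-\frac c2\mp\frac12\sqrt{c^2+4(\lambda-\nu_2)}$, the eigenvalues of $A_\infty(\lambda)$; at $\lambda=0$, $\mu_1<\mu_2<0<\mu_3<\mu_4$. 3. $\varphi$ has exponential rate $\mu_2(0)$ at $+\infty$ and $\mu_3(0)$ at $-\infty$: $\frac1z\log|\varphi(z)|\to\mu_2(0)$ as $z\to+\infty$ and $\to\mu_3(0)$ as $z\to-\infty$. 4. $\varphi$ is transversely constructed: for $(*)$ with $c'=0$ appended, the center-unstable and center-stable manifolds of $(0,0,0,0,c)$ intersect transversely in $\mathbb R^5$ along $(\varphi(z),c)$. (These manifolds consist of the points whose orbits converge to a rest state $(0,k)$ as $z\to-\infty$, resp. $z\to+\infty$; their tangent vectors at $(\varphi(z),c)$ are the velocities of one-parameter families of such half-orbits, differentiable in the parameter uniformly on the half-orbit.) For some $\delta>0$ with $-\delta>\nu_2$, let $u_i(\lambda,z)$, $i=1,\dots,4$,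 $\lambda\in I=[-\delta,\infty)$, be solutions of $Y'=A(\lambda,z)Y$, analytic in $\lambda$, such that $e^{-\mu_i(\lambda)z}u_i(\lambda,z)\to\eta_i(\lambda)$ as $z\to+\infty$ for $i=1,2$ and as $z\to-\infty$ for $i=3,4$, uniformly for $\lambda$ in compact subsets of $I$, where $\eta_i(\lambda)\neq0$ is an eigenvector of $A_\infty(\lambda)$ for $\mu_i(\lambda)$. Normalize so that $u_2(0,z)=u_3(0,z)=\varphi'(z)$ and $\det[\eta_1(0),\eta_2(0),\eta_3(0),\eta_4(0)]>0$. Put $E^s(\lambda,z)=\mathrm{sp}\{u_1,u_2\}$, $E^u(\lambda,z)=\mathrm{sp}\{u_3,u_4\}$, $D(\lambda)=e^{2cz}\det[u_1,u_2,u_3,u_4](\lambda,z)$ (the Evans function), $\omega=de_1\wedge de_3-de_2\wedge de_4$, and $\Omega(u_1,u_4)=e^{cz}\omega(u_1(0,z),u_4(0,z))$ (the Lazutkin–Treschev invariant); the last two do not depend on $z$. Let $V^u(0)$ be the unstable subspace of $A_\infty(0)$ and let $\tau\in\mathbb R$ be such that $V^u(0)\cap E^s(0,\tau')=\{0\}$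 for all $\tau'\ge\tau$. A crossing is a $z^*$ with $E^u(0,z^*)\cap E^s(0,\tau)\ne\{0\}$; its crossing form is the quadratic form $\Gamma_{z^*}(\xi)=\omega(\xi,A(0,z^*)\xi)$ on this intersection, and it is regular if $\Gamma_{z^*}$ is nonsingular. Assume that all crossings $z^*\in(-\infty,\tau]$ are regular. With $n_\pm$ the positive and negative indices of inertia, put $$\mathrm{Maslov}(\varphi)=\sum_{z^*\in(-\infty,\tau)}\bigl(n_+(\Gamma_{z^*})-n_-(\Gamma_{z^*})\bigr)+n_+(\Gamma_\tau),$$ the sum being over the crossings $z^*<\tau$. **Theorem.** There are only finitely many crossings in $(-\infty,\tau]$, and for every $z$ $$(-1)^{\mathrm{Maslov}(\varphi)}=\operatorname{sign}\,\Omega(u_1,u_4)=\operatorname{sign}\bigl(e^{cz}\omega(u_1(0,z),u_4(0,z))\bigr).$$ Moreover $e^{cz}\bigl(\frac{(\hat u')^2}{\sigma}-\frac{(\hat v')^2}{\alpha}\bigr)$ is integrable over $\mathbb R$, $D$ is differentiable at $0$ with $$D'(0)=\Omega(u_1,u_4)\int_{-\infty}^{\infty}e^{cz}\Bigl(\frac{(\hat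 u')^2}{\sigma}-\frac{(\hat v')^2}{\alpha}\Bigr)dz,$$ and consequently $$\operatorname{sign}D'(0)=(-1)^{\mathrm{Maslov}(\varphi)}\operatorname{sign}\int_{-\infty}^{\infty}e^{cz}\Bigl(\frac{(\hat u')^2}{\sigma}-\frac{(\hat v')^2}{\alpha}\Bigr)dz.$$ -/

import Mathlib

open Filter Topology Set MeasureTheory

noncomputable section

/-- Phase space `ℝ⁴` with coordinates `(u, v, w, y)` (indices `0, 1, 2, 3`). -/
abbrev Phase : Type := Fin 4 → ℝ

/-- The data and standing assumptions of the activator-inhibitor system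
`u_t = u_xx + f(u) - σ v`, `v_t = v_xx + g(v) + α u` with rest state `(0,0)`,
which is stable for the reaction kinetics. -/
structure ActivatorInhibitorSystem where
  f : ℝ → ℝ
  g : ℝ → ℝ
  σ : ℝ
  α : ℝ
  f_contDiff : ContDiff ℝ 2 f
  g_contDiff : ContDiff ℝ 2 g
  σ_pos : 0 < σ
  α_pos : 0 < α
  f_zero : f 0 = 0
  g_zero : g 0 = 0
  trace_neg : deriv f 0 + deriv g 0 < 0
  det_pos : 0 < deriv f 0 * deriv g 0 + σ * α

namespace ActivatorInhibitorSystem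

variable (P : ActivatorInhibitorSystem)

/-- The Jacobian `DF(0)` of the reaction term `F(u,v) = (f(u) - σ v, g(v) + α u)`. -/
def reactionJacobian : Matrix (Fin 2) (Fin 2) ℝ :=
  !![deriv P.f 0, -P.σ; P.α, deriv P.g 0]

/-- The vector field of the traveling wave ODE with wave speed `c`. -/
def vectorField (c : ℝ) (p : Phase) : Phase :=
  ![P.σ * p 2,
    P.α * p 3,
    -c * p 2 - P.f (p 0) / P.σ + p 1,
    -c * p 3 - p 0 - P.g (p 1) / P.α]

/-- The coefficient matrix of the first order eigenvalue equation, with `f'` and `g'` evaluated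
at the phase point `p`: for `p = φ(z)` it is `A(λ, z)`, for `p = 0` it is `A_∞(λ)`. -/
def coeffMatrix (c lam : ℝ) (p : Phase) : Matrix (Fin 4) (Fin 4) ℝ :=
  !![0, 0, P.σ, 0;
     0, 0, 0, P.α;
     lam / P.σ - deriv P.f (p 0) / P.σ, 1, -c, 0;
     -1, lam / P.α - deriv P.g (p 1) / P.α, 0, -c]

/-- Pairs `(ψ, k)` such that `ψ` is, on the time interval `S`, an orbit of the traveling wave ODE
with speed `k` that converges to the rest state along the filter `l`. In the phase space `ℝ⁵` of
the system with the equation `c' = 0` appended, `t ↦ (ψ t, k)` is then an orbit converging to the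
fixed point `(0, k)`. For `S = (-∞, z]`, `l = atBot` the points `(ψ z, k)` form the center-unstable
manifold `W^cu` of the curve of rest states, for `S = [z, ∞)`, `l = atTop` the center-stable
manifold `W^cs`. -/
def asymptoticOrbits (S : Set ℝ) (l : Filter ℝ) : Set ((ℝ → Phase) × ℝ) :=
  {q | (∀ t ∈ S, HasDerivWithinAt q.1 (P.vectorField q.2 (q.1 t)) S t) ∧ Tendsto q.1 l (𝓝 0)}

/-- Tangent vectors at `(φ(z), c)`: the velocities at `s = 0` of the points `(Ψ s z, k s)`, for
one-parameter families `(Ψ s, k s)` of orbits in `asymptoticOrbits S l` through `(φ, c)` at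
`s = 0` that are differentiable at `s = 0`, uniformly on the whole half-orbit `S`
(the immersed invariant manifold carries the topology of uniform convergence of half-orbits). -/
def tangentVectors (c : ℝ) (φ : ℝ → Phase) (S : Set ℝ) (l : Filter ℝ) (z : ℝ) :
    Set (Phase × ℝ) :=
  {x | ∃ (Ψ : ℝ → ℝ → Phase) (k : ℝ → ℝ) (Y : ℝ → Phase),
      (∀ s, (Ψ s, k s) ∈ P.asymptoticOrbits S l) ∧
      (∀ t ∈ S, Ψ 0 t = φ t) ∧ k 0 = c ∧
      (∀ ε > 0, ∀ᶠ s in 𝓝 (0 : ℝ), ∀ t ∈ S, ‖Ψ s t - Ψ 0 t - s • Y t‖ ≤ ε * |s|) ∧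
      HasDerivAt k x.2 0 ∧ Y z = x.1}

/-- `T_{(φ(z),c)} W^cu`. -/
def tangentCenterUnstable (c : ℝ) (φ : ℝ → Phase) (z : ℝ) : Submodule ℝ (Phase × ℝ) :=
  Submodule.span ℝ (P.tangentVectors c φ (Iic z) atBot z)

/-- `T_{(φ(z),c)} W^cs`. -/
def tangentCenterStable (c : ℝ) (φ : ℝ → Phase) (z : ℝ) : Submodule ℝ (Phase × ℝ) :=
  Submodule.span ℝ (P.tangentVectors c φ (Ici z) atTop z)

/-- The wave `φ` of speed `c` is transversely constructed: along `(φ(z), c)` the center-unstable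
and center-stable manifolds intersect transversely in `ℝ⁵`. -/
def TransverselyConstructed (c : ℝ) (φ : ℝ → Phase) : Prop :=
  ∀ z, P.tangentCenterUnstable c φ z ⊔ P.tangentCenterStable c φ z = ⊤

end ActivatorInhibitorSystem

/-- The exponents `μ₁(λ), …, μ₄(λ)` (indices `0, …, 3`), the eigenvalues of `A_∞(λ)`; here
`ν₁, ν₂` are the eigenvalues of `DF(0)`. -/
def exponent (c ν₁ ν₂ : ℝ) (i : Fin 4) (lam : ℝ) : ℝ :=
  ![-c / 2 - Real.sqrt (c ^ 2 + 4 * (lam - ν₁)) / 2,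
    -c / 2 - Real.sqrt (c ^ 2 + 4 * (lam - ν₂)) / 2,
    -c / 2 + Real.sqrt (c ^ 2 + 4 * (lam - ν₂)) / 2,
    -c / 2 + Real.sqrt (c ^ 2 + 4 * (lam - ν₁)) / 2] i

/-- A traveling wave `φ = (û, v̂, û'/σ, v̂'/α)` of speed `c`, homoclinic to the rest state, with
the assumptions on speed, tails, decay rates and transversality. -/
structure TravelingWave (P : ActivatorInhibitorSystem) where
  c : ℝ
  φ : ℝ → Phase
  ν₁ : ℝ
  ν₂ : ℝ
  solves : ∀ z, HasDerivAt φ (P.vectorField c (φ z)) z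
  exp_decay : ∃ K > 0, ∃ κ > 0, ∀ z, ‖φ z‖ ≤ K * Real.exp (-κ * |z|)
  speed_neg : c < 0
  eigenvalue₁ : Module.End.HasEigenvalue (Matrix.toLin' P.reactionJacobian) ν₁
  eigenvalue₂ : Module.End.HasEigenvalue (Matrix.toLin' P.reactionJacobian) ν₂
  ν₁_lt_ν₂ : ν₁ < ν₂
  ν₂_neg : ν₂ < 0
  /-- the exponential decay rate of `φ` at `+∞` is the leading stable exponent `μ₂(0)` -/
  rate_atTop : Tendsto (fun z => Real.log ‖φ z‖ / z) atTop (𝓝 (exponent c ν₁ ν₂ 1 0))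
  /-- the exponential decay rate of `φ` at `-∞` is the leading unstable exponent `μ₃(0)` -/
  rate_atBot : Tendsto (fun z => Real.log ‖φ z‖ / z) atBot (𝓝 (exponent c ν₁ ν₂ 2 0))
  transverse : P.TransverselyConstructed c φ

/-- The complex structure `J` with `ω(a,b) = ⟨a, J b⟩`. -/
def matrixJ : Matrix (Fin 4) (Fin 4) ℝ :=
  !![0, 0, 1, 0; 0, 0, 0, -1; -1, 0, 0, 0; 0, 1, 0, 0]

/-- The symplectic form `ω = de₁ ∧ de₃ - de₂ ∧ de₄` on `ℝ⁴`. -/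
def omega : LinearMap.BilinForm ℝ Phase := Matrix.toBilin' matrixJ

theorem omega_apply (a b : Phase) :
    omega a b = (a 0 * b 2 - a 2 * b 0) - (a 1 * b 3 - a 3 * b 1) := by
  simp [omega, matrixJ, Matrix.toBilin'_apply, Fin.sum_univ_four]
  ring

/-- The stable bundle `E^s(λ, z) = sp{u₁(λ,z), u₂(λ,z)}`. -/
def stableBundle (u : Fin 4 → ℝ → ℝ → Phase) (lam z : ℝ) : Submodule ℝ Phase :=
  Submodule.span ℝ {u 0 lam z, u 1 lam z}

/-- The unstable bundle `E^u(λ, z) = sp{u₃(λ,z), u₄(λ,z)}`. -/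
def unstableBundle (u : Fin 4 → ℝ → ℝ → Phase) (lam z : ℝ) : Submodule ℝ Phase :=
  Submodule.span ℝ {u 2 lam z, u 3 lam z}

namespace TravelingWave

variable {P : ActivatorInhibitorSystem} (w : TravelingWave P)

/-- `μ_{i+1}(λ)`. -/
def μ (i : Fin 4) (lam : ℝ) : ℝ := exponent w.c w.ν₁ w.ν₂ i lam

/-- The matrix `A(λ, z)`. -/
def A (lam z : ℝ) : Matrix (Fin 4) (Fin 4) ℝ := P.coeffMatrix w.c lam (w.φ z)

/-- The asymptotic matrix `A_∞(λ)`. -/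
def AInf (lam : ℝ) : Matrix (Fin 4) (Fin 4) ℝ := P.coeffMatrix w.c lam 0

/-- The unstable subspace `V^u(0)` of the linearization of the traveling wave ODE at the rest
state, spanned by the eigenvectors for the positive eigenvalues `μ₃(0), μ₄(0)`. -/
def unstableSubspace : Submodule ℝ Phase :=
  Module.End.eigenspace (Matrix.toLin' (w.AInf 0)) (w.μ 2 0) ⊔
    Module.End.eigenspace (Matrix.toLin' (w.AInf 0)) (w.μ 3 0)

/-- A normalized choice of the solutions `u₁, …, u₄` (indices `0, …, 3`) of `Y' = A(λ,z) Y`,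
for `λ ∈ I = [-δ, ∞)`, that span the stable and the unstable bundle, with the eigenvectors `η_i`
which they approach. -/
structure IsAdaptedBasis (δ : ℝ) (u : Fin 4 → ℝ → ℝ → Phase) (η : Fin 4 → ℝ → Phase) :
    Prop where
  δ_pos : 0 < δ
  δ_lt : w.ν₂ < -δ
  solves : ∀ i, ∀ lam ∈ Ici (-δ), ∀ z,
    HasDerivAt (u i lam) (Matrix.mulVec (w.A lam z) (u i lam z)) z
  analytic : ∀ i z, AnalyticOn ℝ (fun lam => u i lam z) (Ici (-δ))
  eigenvector : ∀ i, ∀ lam ∈ Ici (-δ),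
    Module.End.HasEigenvector (Matrix.toLin' (w.AInf lam)) (w.μ i lam) (η i lam)
  limit_atTop : ∀ i : Fin 4, i = 0 ∨ i = 1 → ∀ K ⊆ Ici (-δ), IsCompact K →
    TendstoUniformlyOn (fun z lam => Real.exp (-(w.μ i lam) * z) • u i lam z) (η i) atTop K
  limit_atBot : ∀ i : Fin 4, i = 2 ∨ i = 3 → ∀ K ⊆ Ici (-δ), IsCompact K →
    TendstoUniformlyOn (fun z lam => Real.exp (-(w.μ i lam) * z) • u i lam z) (η i) atBot K
  /-- at `λ = 0`, `u₂ = φ'` -/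
  u₂_eq : ∀ z, u 1 0 z = deriv w.φ z
  /-- at `λ = 0`, `u₃ = φ'` -/
  u₃_eq : ∀ z, u 2 0 z = deriv w.φ z
  /-- `η₁(0) ∧ η₂(0) ∧ η₃(0) ∧ η₄(0) = ρ vol` with `ρ > 0` -/
  orientation : 0 < Matrix.det (Matrix.of fun i j : Fin 4 => η j 0 i)

/-- `Ω(a, b) = e^{cz} ω(a, b)`. -/
def bigOmega (z : ℝ) (a b : Phase) : ℝ := Real.exp (w.c * z) * omega a b

/-- The Lazutkin-Treschev invariant `Ω(u₁, u₄) = e^{cz} ω(u₁(0,z), u₄(0,z))`, evaluated at `z`. -/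
def lazutkinTreschev (u : Fin 4 → ℝ → ℝ → Phase) (z : ℝ) : ℝ :=
  w.bigOmega z (u 0 0 z) (u 3 0 z)

/-- The Evans function `D(λ) = e^{2cz} det[u₁, u₂, u₃, u₄](λ, z)`, evaluated at `z`. -/
def evans (u : Fin 4 → ℝ → ℝ → Phase) (z lam : ℝ) : ℝ :=
  Real.exp (2 * w.c * z) * Matrix.det (Matrix.of fun i j : Fin 4 => u j lam z i)

/-- `z` is a crossing of the unstable bundle `E^u(0, ·)` with the train of `E^s(0, τ)`. -/
def IsCrossing (u : Fin 4 → ℝ → ℝ → Phase) (τ z : ℝ) : Prop :=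
  unstableBundle u 0 z ⊓ stableBundle u 0 τ ≠ ⊥

/-- The crossing form `Γ(ξ) = ω(ξ, A(0,z) ξ)` on `E^u(0,z) ∩ E^s(0,τ)`. -/
def crossingForm (u : Fin 4 → ℝ → ℝ → Phase) (τ z : ℝ) :
    QuadraticForm ℝ ↥(unstableBundle u 0 z ⊓ stableBundle u 0 τ) :=
  (LinearMap.BilinMap.toQuadraticMap
    (LinearMap.BilinForm.compRight omega (Matrix.toLin' (w.A 0 z)))).restrict _

/-- The crossing form at `z` is nonsingular. -/
def IsRegular (u : Fin 4 → ℝ → ℝ → Phase) (τ z : ℝ) : Prop :=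
  LinearMap.BilinForm.Nondegenerate (w.crossingForm u τ z).polarBilin

/-- The Maslov index of the wave: the signatures of the crossing forms at the crossings in
`(-∞, τ)`, plus the positive index of inertia at the right endpoint `τ`. -/
def maslov (u : Fin 4 → ℝ → ℝ → Phase) (τ : ℝ) : ℤ :=
  (∑ᶠ z ∈ {z | z < τ ∧ IsCrossing u τ z},
      ((sigPos (w.crossingForm u τ z) : ℤ) - (sigNeg (w.crossingForm u τ z) : ℤ))) +
    (sigPos (w.crossingForm u τ τ) : ℤ)

/-- The density `e^{cz} ((û')²/σ - (v̂')²/α)`. -/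
def waveDensity (z : ℝ) : ℝ :=
  Real.exp (w.c * z) *
    ((deriv (fun t => w.φ t 0) z) ^ 2 / P.σ - (deriv (fun t => w.φ t 1) z) ^ 2 / P.α)

end TravelingWave

end

/-! Everything rests on one identity (`omega_coeffMatrix`): `A(λ,z) + c/2` is infinitesimally
symplectic for `ω`. Hence `Ω = e^{cz} ω` is constant along two solutions with the same `λ`, and
along solutions for `λ` and `μ` its derivative is `(μ - λ) e^{cz}` times `diffForm`. Moreover `ω ∧ ω
= 2 vol`, so a `4 × 4` determinant is a polynomial in values of `ω` (`detCols`), and both the Evans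
function and the crossing condition become statements about `ω`.

Derivative of `D`. Decay makes `E^s` and `E^u` Lagrangian. At `λ = 0` also `u₂ = u₃`, so in the
expansion of `D` every term except `ω(u₁,u₄) ω(u₂,u₃)` has a double zero, or a zero factor that is
multiplied by another one. What remains is the derivative of `ω(u₂,u₃)`; its two halves are tail
integrals of `waveDensity` over the two half-lines (`hasDerivAt_omega_u₂`, `hasDerivAt_omega_u₃`).

Nonvanishing of `Ω(u₁,u₄)`. If it were zero, then `E^u = E^s`. Each decaying solution `a` yields a
Melnikov relation `ω(a, y) = m κ` for the tangent vectors `(y, κ)` of the invariant manifold at its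
end (`omega_velocity`). The plane being two-dimensional, some nonzero combination has the same `m`
for both manifolds, which is a nonzero covector annihilating both tangent spaces and contradicts
transversality (`omega_u₁_u₄_ne_zero`).

Parity. Crossings are the zeros of `β(z) = det[u₁(τ), u₂(τ), u₃(z), u₄(z)]`. At a regular crossing
the order of the zero is the dimension of the intersection (`exists_tendsto_detCols_div_pow`), that
is `n₊ + n₋`, which has the parity of `n₊ - n₋`. The orientation of the `η_i` and the choice of `τ`
give `β > 0` near `-∞`, so the sum over `z < τ` determines the sign of `β` just before `τ`. There
the sign can be computed a second time from `β'(τ) = ω(u₁,u₄) ω(φ', Aφ')`. Comparing the two, the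
contribution of `φ'` cancels against the endpoint term `n₊(Γ_τ)` and the sign of `Ω(u₁,u₄)` is left
(`neg_one_zpow_maslov`). -/

noncomputable section

/-! ### The symplectic form and the linearized equation -/

namespace ActivatorInhibitorSystem

/-- The symmetric form `a₀ b₀ / σ - a₁ b₁ / α`. -/
def diffForm (P : ActivatorInhibitorSystem) (a b : Phase) : ℝ :=
  a 0 * b 0 / P.σ - a 1 * b 1 / P.α

theorem coeffMatrix_mulVec (P : ActivatorInhibitorSystem) (c lam : ℝ) (p a : Phase) :
    Matrix.mulVec (P.coeffMatrix c lam p) a =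
      ![P.σ * a 2, P.α * a 3,
        (lam / P.σ - deriv P.f (p 0) / P.σ) * a 0 + a 1 - c * a 2,
        -a 0 + (lam / P.α - deriv P.g (p 1) / P.α) * a 1 - c * a 3] := by
  ext i
  fin_cases i <;> simp [coeffMatrix, Matrix.mulVec, dotProduct, Fin.sum_univ_four] <;> ring

/-- The coupling entries `1` and `-1` cancel because of the minus sign in `ω`; the terms with `f'`
and `g'` are symmetric and cancel too. Only the friction and the difference of the spectral
parameters survive. -/
theorem omega_coeffMatrix (P : ActivatorInhibitorSystem) (c lam mu : ℝ) (p a b : Phase) :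
    omega (Matrix.mulVec (P.coeffMatrix c lam p) a) b +
      omega a (Matrix.mulVec (P.coeffMatrix c mu p) b) =
      -c * omega a b + (mu - lam) * P.diffForm a b := by
  have h1 := P.σ_pos.ne'
  have h2 := P.α_pos.ne'
  simp only [coeffMatrix_mulVec, omega_apply, diffForm]
  simp
  field_simp
  ring

theorem abs_diffForm_le (P : ActivatorInhibitorSystem) (a b : Phase) :
    |P.diffForm a b| ≤ (1 / P.σ + 1 / P.α) * (‖a‖ * ‖b‖) := by
  have h1 := P.σ_pos
  have h2 := P.α_pos
  have key : ∀ i : Fin 4, |a i * b i| ≤ ‖a‖ * ‖b‖ := fun i => by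
    rw [abs_mul]
    exact mul_le_mul (norm_le_pi_norm a i) (norm_le_pi_norm b i) (abs_nonneg _) (norm_nonneg _)
  calc |P.diffForm a b| ≤ |a 0 * b 0 / P.σ| + |a 1 * b 1 / P.α| := abs_sub _ _
    _ = |a 0 * b 0| / P.σ + |a 1 * b 1| / P.α := by
      rw [abs_div, abs_div, abs_of_pos h1, abs_of_pos h2]
    _ ≤ ‖a‖ * ‖b‖ / P.σ + ‖a‖ * ‖b‖ / P.α := by gcongr <;> apply key
    _ = _ := by ring

theorem continuous_deriv_f (P : ActivatorInhibitorSystem) : Continuous (deriv P.f) :=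
  P.f_contDiff.continuous_deriv (by norm_num)

theorem continuous_deriv_g (P : ActivatorInhibitorSystem) : Continuous (deriv P.g) :=
  P.g_contDiff.continuous_deriv (by norm_num)

end ActivatorInhibitorSystem

theorem omega_self (a : Phase) : omega a a = 0 := by rw [omega_apply]; ring

theorem omega_swap (a b : Phase) : omega a b = -omega b a := by
  rw [omega_apply, omega_apply]; ring

theorem abs_omega_le (a b : Phase) : |omega a b| ≤ 4 * (‖a‖ * ‖b‖) := by
  have key : ∀ i j : Fin 4, |a i * b j| ≤ ‖a‖ * ‖b‖ := fun i j => by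
    rw [abs_mul]
    exact mul_le_mul (norm_le_pi_norm a i) (norm_le_pi_norm b j) (abs_nonneg _) (norm_nonneg _)
  rw [omega_apply, abs_le]
  have h1 := abs_le.1 (key 0 2)
  have h2 := abs_le.1 (key 2 0)
  have h3 := abs_le.1 (key 1 3)
  have h4 := abs_le.1 (key 3 1)
  constructor <;> linarith [h1.1, h1.2]

theorem omega_nondegenerate {x : Phase} (h : ∀ y, omega x y = 0) : x = 0 := by
  have h0 := h (Pi.single 0 1)
  have h1 := h (Pi.single 1 1)
  have h2 := h (Pi.single 2 1)
  have h3 := h (Pi.single 3 1)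
  simp [omega_apply] at h0 h1 h2 h3
  ext i
  fin_cases i <;> simp_all

/-- The determinant of four phase vectors as columns. -/
def detCols (a b c d : Phase) : ℝ :=
  omega a b * omega c d - omega a c * omega b d + omega a d * omega b c

theorem det_of_columns (v : Fin 4 → Phase) :
    Matrix.det (Matrix.of fun i j : Fin 4 => v j i) = detCols (v 0) (v 1) (v 2) (v 3) := by
  simp [Matrix.det_succ_row_zero, Fin.sum_univ_succ, detCols, omega_apply, Fin.succAbove]
  ring

theorem continuous_omega : Continuous fun p : Phase × Phase => omega p.1 p.2 := by
  simp only [omega_apply]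
  fun_prop

theorem HasDerivWithinAt.omega {a b : ℝ → Phase} {a' b' : Phase} {s : Set ℝ} {z : ℝ}
    (ha : HasDerivWithinAt a a' s z) (hb : HasDerivWithinAt b b' s z) :
    HasDerivWithinAt (fun t => _root_.omega (a t) (b t))
      (_root_.omega a' (b z) + _root_.omega (a z) b') s z := by
  have ha := hasDerivWithinAt_pi.1 ha
  have hb := hasDerivWithinAt_pi.1 hb
  simp only [omega_apply]
  refine ((((ha 0).mul (hb 2)).sub ((ha 2).mul (hb 0))).sub
    (((ha 1).mul (hb 3)).sub ((ha 3).mul (hb 1)))).congr_deriv ?_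
  ring

theorem HasDerivAt.omega {a b : ℝ → Phase} {a' b' : Phase} {z : ℝ}
    (ha : HasDerivAt a a' z) (hb : HasDerivAt b b' z) :
    HasDerivAt (fun t => _root_.omega (a t) (b t))
      (_root_.omega a' (b z) + _root_.omega (a z) b') z := by
  rw [← hasDerivWithinAt_univ] at *
  exact ha.omega hb

/-! ### Conservation of `Ω` and growth bounds for solutions -/

namespace TravelingWave

variable {P : ActivatorInhibitorSystem} (w : TravelingWave P)

theorem hasDerivWithinAt_bigOmega {a b : ℝ → Phase} {a' b' : Phase} {s : Set ℝ} {z : ℝ}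
    (ha : HasDerivWithinAt a a' s z) (hb : HasDerivWithinAt b b' s z) :
    HasDerivWithinAt (fun t => w.bigOmega t (a t) (b t))
      (Real.exp (w.c * z) * (w.c * omega (a z) (b z) + (omega a' (b z) + omega (a z) b'))) s z := by
  have h : HasDerivWithinAt (fun t => Real.exp (w.c * t)) (Real.exp (w.c * z) * w.c) s z := by
    simpa using (((hasDerivAt_id z).const_mul w.c).exp).hasDerivWithinAt
  refine (h.mul (ha.omega hb)).congr_deriv ?_
  ring

theorem hasDerivAt_bigOmega {lam mu : ℝ} {a b : ℝ → Phase} {z : ℝ}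
    (ha : HasDerivAt a (Matrix.mulVec (w.A lam z) (a z)) z)
    (hb : HasDerivAt b (Matrix.mulVec (w.A mu z) (b z)) z) :
    HasDerivAt (fun t => w.bigOmega t (a t) (b t))
      (Real.exp (w.c * z) * ((mu - lam) * P.diffForm (a z) (b z))) z := by
  rw [← hasDerivWithinAt_univ] at *
  refine (w.hasDerivWithinAt_bigOmega ha hb).congr_deriv ?_
  have := P.omega_coeffMatrix w.c lam mu (w.φ z) (a z) (b z)
  rw [A, A, this]
  ring

theorem abs_bigOmega_le (z : ℝ) (a b : Phase) :
    |w.bigOmega z a b| ≤ 4 * (Real.exp (w.c * z) * (‖a‖ * ‖b‖)) := by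
  rw [bigOmega, abs_mul, abs_of_pos (Real.exp_pos _)]
  nlinarith [abs_omega_le a b, Real.exp_pos (w.c * z)]

theorem bigOmega_zero (a b : Phase) : w.bigOmega 0 a b = omega a b := by simp [bigOmega]

/-- `Ω(a, b)` is constant along solutions of the same eigenvalue equation. -/
theorem bigOmega_eq {lam : ℝ} {a b : ℝ → Phase}
    (ha : ∀ z, HasDerivAt a (Matrix.mulVec (w.A lam z) (a z)) z)
    (hb : ∀ z, HasDerivAt b (Matrix.mulVec (w.A lam z) (b z)) z) (z z' : ℝ) :
    w.bigOmega z (a z) (b z) = w.bigOmega z' (a z') (b z') := by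
  have h : ∀ t, HasDerivAt (fun t => w.bigOmega t (a t) (b t)) 0 t := fun t => by
    simpa using w.hasDerivAt_bigOmega (ha t) (hb t)
  exact is_const_of_deriv_eq_zero (fun t => (h t).differentiableAt) (fun t => (h t).deriv) z z'

theorem φ_continuous : Continuous w.φ :=
  continuous_iff_continuousAt.2 fun z => (w.solves z).continuousAt

theorem exists_norm_φ_le : ∃ M > 0, ∀ z, ‖w.φ z‖ ≤ M := by
  obtain ⟨K, hK, κ, hκ, h⟩ := w.exp_decay
  refine ⟨K, hK, fun z => (h z).trans ?_⟩
  have : Real.exp (-κ * |z|) ≤ 1 := Real.exp_le_one_iff.2 (by nlinarith [abs_nonneg z])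
  nlinarith

theorem deriv_φ (z : ℝ) : deriv w.φ z = P.vectorField w.c (w.φ z) := (w.solves z).deriv

theorem waveDensity_eq (z : ℝ) :
    w.waveDensity z = Real.exp (w.c * z) * P.diffForm (deriv w.φ z) (deriv w.φ z) := by
  have h := hasDerivAt_pi.1 (w.solves z)
  rw [waveDensity, (h 0).deriv, (h 1).deriv, ActivatorInhibitorSystem.diffForm, deriv_φ]
  ring

theorem continuous_A_mulVec (lam : ℝ) :
    Continuous fun q : ℝ × Phase => Matrix.mulVec (w.A lam q.1) q.2 := by
  have h0 := w.φ_continuous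
  have hf := P.continuous_deriv_f
  have hg := P.continuous_deriv_g
  simp only [A, P.coeffMatrix_mulVec]
  refine continuous_pi fun i => ?_
  fin_cases i <;> simp <;> fun_prop

/-- The linear vector field `A(λ, z)` is bounded, uniformly in `z` and in `λ ∈ [-Λ, Λ]`. -/
theorem exists_norm_A_mulVec_le (Λ : ℝ) :
    ∃ L : NNReal, ∀ lam, |lam| ≤ Λ → ∀ z a, ‖Matrix.mulVec (w.A lam z) a‖ ≤ L * ‖a‖ := by
  obtain ⟨M, -, hM⟩ := w.exists_norm_φ_le
  have bdd : ∀ f : ℝ → ℝ, Continuous f → ∃ C ≥ 0, ∀ z i, |f (w.φ z i)| ≤ C := fun f hf => by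
    obtain ⟨C, hC⟩ := (isCompact_Icc (a := -M) (b := M)).exists_bound_of_continuousOn hf.continuousOn
    refine ⟨max C 0, le_max_right _ _, fun z i => (hC _ ?_).trans (le_max_left _ _)⟩
    exact abs_le.1 ((norm_le_pi_norm (w.φ z) i).trans (hM z))
  obtain ⟨C₁, h1, hf⟩ := bdd _ (P.continuous_deriv_f)
  obtain ⟨C₂, h2, hg⟩ := bdd _ (P.continuous_deriv_g)
  have hσ := P.σ_pos
  have hα := P.α_pos
  refine ⟨Real.toNNReal (P.σ + P.α + ((Λ + C₁) / P.σ + 1 + |w.c|) + (1 + (Λ + C₂) / P.α + |w.c|)),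
    fun lam hlam z a => ?_⟩
  have hΛ : 0 ≤ Λ := (abs_nonneg _).trans hlam
  have e1 : 0 ≤ (Λ + C₁) / P.σ := by positivity
  have e2 : 0 ≤ (Λ + C₂) / P.α := by positivity
  have e3 := abs_nonneg w.c
  rw [Real.coe_toNNReal _ (by positivity), A, P.coeffMatrix_mulVec]
  have ha : ∀ i, |a i| ≤ ‖a‖ := norm_le_pi_norm a
  have n0 := norm_nonneg a
  have key : ∀ x y s : ℝ, 0 < s → |x| ≤ Λ → ∀ C, |y| ≤ C → |x / s - y / s| ≤ (Λ + C) / s :=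
    fun x y s hs hx C hy => by
      rw [← sub_div, abs_div, abs_of_pos hs]
      gcongr
      exact (abs_sub _ _).trans (add_le_add hx hy)
  have k1 := key lam _ _ hσ hlam _ (hf z 0)
  have k2 := key lam _ _ hα hlam _ (hg z 1)
  have m1 : ∀ x y C : ℝ, |x| ≤ C → |y| ≤ ‖a‖ → |x * y| ≤ C * ‖a‖ := fun x y C hx hy => by
    rw [abs_mul]
    exact mul_le_mul hx hy (abs_nonneg _) ((abs_nonneg _).trans hx)
  have t1 := m1 _ _ _ k1 (ha 0)
  have t2 := m1 _ _ _ k2 (ha 1)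
  have t3 := m1 w.c _ _ le_rfl (ha 2)
  have t4 := m1 w.c _ _ le_rfl (ha 3)
  have t5 := m1 P.σ _ _ (abs_of_pos hσ).le (ha 2)
  have t6 := m1 P.α _ _ (abs_of_pos hα).le (ha 3)
  have q1 := mul_nonneg e1 n0
  have q2 := mul_nonneg e2 n0
  have q3 := mul_nonneg e3 n0
  have q4 := mul_nonneg hσ.le n0
  have q5 := mul_nonneg hα.le n0
  rw [pi_norm_le_iff_of_nonneg (by positivity)]
  intro i
  have a0 := ha 0
  have a1 := ha 1
  rw [abs_le] at t1 t2 t3 t4 t5 t6 a0 a1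
  fin_cases i <;> simp only [Real.norm_eq_abs, abs_le] <;> simp <;> constructor <;> linarith

/-- Grönwall's inequality; backward times are reduced to forward ones by reflecting the solution. -/
theorem norm_solution_le {Λ : ℝ} {L : NNReal}
    (hL : ∀ lam, |lam| ≤ Λ → ∀ z a, ‖Matrix.mulVec (w.A lam z) a‖ ≤ L * ‖a‖) {lam : ℝ}
    (hlam : |lam| ≤ Λ) {a : ℝ → Phase}
    (ha : ∀ z, HasDerivAt a (Matrix.mulVec (w.A lam z) (a z)) z) (s t : ℝ) :
    ‖a t‖ ≤ ‖a s‖ * Real.exp (L * |t - s|) := by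
  have key : ∀ (b b' : ℝ → Phase), (∀ z, HasDerivAt b (b' z) z) →
      (∀ z, ‖b' z‖ ≤ L * ‖b z‖) → ∀ r, 0 ≤ r → ‖b r‖ ≤ ‖b 0‖ * Real.exp (L * r) := by
    intro b b' hb hb' r hr
    have := norm_le_gronwallBound_of_norm_deriv_right_le (f := b) (f' := b') (a := 0) (b := r)
      (δ := ‖b 0‖) (K := L) (ε := 0) (fun z _ => (hb z).continuousAt.continuousWithinAt)
      (fun z _ => (hb z).hasDerivWithinAt) le_rfl (fun z _ => by simpa using hb' z) r ⟨hr, le_rfl⟩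
    simpa [gronwallBound_ε0] using this
  rcases le_total s t with h | h
  · have := key (fun r => a (s + r)) (fun r => Matrix.mulVec (w.A lam (s + r)) (a (s + r)))
      (fun z => (ha (s + z)).comp_const_add s z) (fun z => hL lam hlam _ _) (t - s) (by linarith)
    simpa [abs_of_nonneg (sub_nonneg.2 h)] using this
  · have := key (fun r => a (s - r)) (fun r => -Matrix.mulVec (w.A lam (s - r)) (a (s - r)))
      (fun z => (ha (s - z)).comp_const_sub s z) (fun z => by rw [norm_neg]; exact hL lam hlam _ _)
      (s - t) (by linarith)
    rw [abs_sub_comm]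
    simpa [abs_of_nonneg (sub_nonneg.2 h)] using this

theorem eq_zero_of_solution {lam : ℝ} {a : ℝ → Phase}
    (ha : ∀ z, HasDerivAt a (Matrix.mulVec (w.A lam z) (a z)) z) {s : ℝ} (hs : a s = 0) (t : ℝ) :
    a t = 0 := by
  obtain ⟨L, hL⟩ := w.exists_norm_A_mulVec_le |lam|
  have := w.norm_solution_le hL le_rfl ha s t
  rw [hs] at this
  simpa using this

end TravelingWave

/-! ### Exponential bounds uniform in `λ` -/

/-- Past some time `Z` the weighted solution stays within `1` of its limit, hence within `2` of its
value at `Z`, so no bound on the limit is needed. The value at `Z` is bounded by compactness, and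
the interval `[0, Z]` is covered by the growth estimate. -/
theorem exists_norm_le_exp_of_tendstoUniformlyOn {E : Type*} [NormedAddCommGroup E]
    [NormedSpace ℝ E] {U : ℝ → ℝ → E} {μ : ℝ → ℝ} {η : ℝ → E}
    {K : Set ℝ} (hK : IsCompact K) (hμ : ContinuousOn μ K)
    (hU : ∀ z, ContinuousOn (fun lam => U lam z) K)
    (hlim : TendstoUniformlyOn (fun z lam => Real.exp (-(μ lam) * z) • U lam z) η atTop K) {L : NNReal}
    (hL : ∀ lam ∈ K, ∀ s t, ‖U lam t‖ ≤ ‖U lam s‖ * Real.exp (L * |t - s|)) :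
    ∃ C ≥ 0, ∀ lam ∈ K, ∀ z ≥ 0, ‖U lam z‖ ≤ C * Real.exp (μ lam * z) := by
  have h1 := (Metric.tendstoUniformlyOn_iff.1 hlim) 1 one_pos
  obtain ⟨Z, hZ0, hZ⟩ := (h1.and (eventually_ge_atTop 0)).exists_forall_of_atTop.imp fun Z h =>
    And.intro (h Z le_rfl).2 fun z hz => (h z hz).1
  obtain ⟨B, hB⟩ := hK.exists_bound_of_continuousOn (hU Z)
  obtain ⟨m, hm⟩ := hK.exists_bound_of_continuousOn hμ
  -- `B e^{LZ}` bounds the solution on `[0, Z]` when it is followed back from `Z`; the factor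
  -- `e^{|m|Z}` compensates the smallest possible value of `e^{μ(λ) t}` there.
  set C₁ := B * Real.exp (L * Z) * Real.exp (|m| * Z)
  refine ⟨max (max C₁ (C₁ + 2)) 0, le_max_right _ _, fun lam hlam z hz => ?_⟩
  have hB0 : 0 ≤ B := (norm_nonneg _).trans (hB lam hlam)
  have hm' : |μ lam| ≤ |m| := (hm lam hlam).trans (le_abs_self m)
  have large : ∀ t, 0 ≤ t → t ≤ Z → ‖U lam t‖ ≤ C₁ * Real.exp (μ lam * t) := fun t ht htZ => by
    have e1 : Real.exp (L * |t - Z|) ≤ Real.exp (L * Z) := by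
      gcongr
      rw [abs_le]; constructor <;> linarith
    have e2 : 1 ≤ Real.exp (|m| * Z) * Real.exp (μ lam * t) := by
      rw [← Real.exp_add]
      refine Real.one_le_exp ?_
      have := (abs_le.1 hm').1
      nlinarith [abs_nonneg m]
    calc ‖U lam t‖ ≤ ‖U lam Z‖ * Real.exp (L * |t - Z|) := hL lam hlam Z t
      _ ≤ B * Real.exp (L * Z) := by gcongr; exact hB lam hlam
      _ ≤ B * Real.exp (L * Z) * (Real.exp (|m| * Z) * Real.exp (μ lam * t)) :=
        le_mul_of_one_le_right (by positivity) e2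
      _ = _ := by ring
  rcases le_total z Z with h | h
  · refine (large z hz h).trans ?_
    gcongr
    exact (le_max_left _ _).trans (le_max_left _ _)
  · have h2 := hZ z h lam hlam
    have h3 := hZ Z le_rfl lam hlam
    have sc : ∀ t, ‖Real.exp (-(μ lam) * t) • U lam t‖ = Real.exp (-(μ lam) * t) * ‖U lam t‖ :=
      fun t => by rw [norm_smul, Real.norm_eq_abs, abs_of_pos (Real.exp_pos _)]
    have h4 : ‖Real.exp (-(μ lam) * z) • U lam z‖ ≤ ‖Real.exp (-(μ lam) * Z) • U lam Z‖ + 2 := by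
      have := norm_sub_norm_le (Real.exp (-(μ lam) * z) • U lam z) (Real.exp (-(μ lam) * Z) • U lam Z)
      rw [← dist_eq_norm] at this
      have := dist_triangle_left (Real.exp (-(μ lam) * z) • U lam z)
        (Real.exp (-(μ lam) * Z) • U lam Z) (η lam)
      linarith
    have h5 : ‖Real.exp (-(μ lam) * Z) • U lam Z‖ ≤ C₁ := by
      rw [sc]
      calc _ ≤ Real.exp (-(μ lam) * Z) * (C₁ * Real.exp (μ lam * Z)) := by
            gcongr; exact large Z hZ0 le_rfl
        _ = C₁ * (Real.exp (-(μ lam) * Z) * Real.exp (μ lam * Z)) := by ring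
        _ = C₁ := by rw [← Real.exp_add]; simp
    rw [sc] at h4
    calc ‖U lam z‖ = Real.exp (-(μ lam) * z) * ‖U lam z‖ * Real.exp (μ lam * z) := by
          rw [mul_right_comm, ← Real.exp_add]; simp
      _ ≤ (C₁ + 2) * Real.exp (μ lam * z) := by gcongr; linarith
      _ ≤ _ := by gcongr; exact (le_max_right _ _).trans (le_max_left _ _)

theorem tendstoUniformlyOn_comp_neg {E : Type*} [NormedAddCommGroup E]
    [NormedSpace ℝ E] {U : ℝ → ℝ → E} {μ : ℝ → ℝ} {η : ℝ → E} {K : Set ℝ}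
    (hlim : TendstoUniformlyOn (fun z lam => Real.exp (-(μ lam) * z) • U lam z) η atBot K) :
    TendstoUniformlyOn (fun z lam => Real.exp (-(-(μ lam)) * z) • U lam (-z)) η atTop K := by
  have := fun v hv => tendsto_neg_atTop_atBot.eventually (hlim v hv)
  refine fun v hv => (this v hv).mono fun z hz lam hlam => ?_
  simpa using hz lam hlam

/-! ### The spectral gap and decay at the two ends -/

namespace TravelingWave

variable {P : ActivatorInhibitorSystem} (w : TravelingWave P)

/-- Half the spectral gap: `(μ₃(0) - μ₂(0)) / 2`. -/
def gap : ℝ := Real.sqrt (w.c ^ 2 + 4 * (0 - w.ν₂)) / 2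

theorem abs_c_lt_gap : |w.c| / 2 < w.gap := by
  have h := w.ν₂_neg
  rw [gap]
  have : |w.c| < Real.sqrt (w.c ^ 2 + 4 * (0 - w.ν₂)) := by
    rw [Real.lt_sqrt (abs_nonneg _), sq_abs]; linarith
  linarith

theorem gap_pos : 0 < w.gap := lt_of_le_of_lt (by positivity) w.abs_c_lt_gap

/-- The two summands `-c/2` cancel `c`, and the square root belonging to `λ` only helps. The
resulting rate is independent of `λ`, which is what dominated convergence requires. -/
theorem c_add_μ_one_le (lam : ℝ) : w.c + w.μ 1 lam + w.μ 1 0 ≤ -w.gap := by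
  have := Real.sqrt_nonneg (w.c ^ 2 + 4 * (lam - w.ν₂))
  simp [μ, exponent, gap]
  linarith

theorem le_c_add_μ_two (lam : ℝ) : w.gap ≤ w.c + w.μ 2 lam + w.μ 2 0 := by
  have := Real.sqrt_nonneg (w.c ^ 2 + 4 * (lam - w.ν₂))
  simp [μ, exponent, gap]
  linarith

theorem gap_lt : w.gap < Real.sqrt (w.c ^ 2 + 4 * (0 - w.ν₁)) / 2 := by
  have h1 := w.ν₁_lt_ν₂
  have h2 := w.ν₂_neg
  have : Real.sqrt (w.c ^ 2 + 4 * (0 - w.ν₂)) < Real.sqrt (w.c ^ 2 + 4 * (0 - w.ν₁)) :=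
    Real.sqrt_lt_sqrt (by nlinarith [sq_nonneg w.c]) (by linarith)
  rw [gap]; linarith

theorem μ_zero_eq (i : Fin 4) : w.μ i 0 =
    ![-w.c / 2 - Real.sqrt (w.c ^ 2 + 4 * (0 - w.ν₁)) / 2, -w.c / 2 - w.gap,
      -w.c / 2 + w.gap, -w.c / 2 + Real.sqrt (w.c ^ 2 + 4 * (0 - w.ν₁)) / 2] i := rfl

/-- Since `|c|/2 < gap`, the exponents keep their sign after `c` is added: decay survives
multiplication by the weight `e^{cz}`. -/
theorem stable_exponents :
    w.μ 0 0 < w.μ 1 0 ∧ w.μ 1 0 < 0 ∧ w.c + w.μ 1 0 < 0 ∧ w.c + w.μ 0 0 < 0 := by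
  have h1 := w.abs_c_lt_gap
  have h2 := w.gap_lt
  have h3 := abs_le.1 (le_refl |w.c|)
  simp only [μ_zero_eq]
  refine ⟨?_, ?_, ?_, ?_⟩ <;> simp at h2 ⊢ <;> linarith [h3.1, h3.2]

theorem unstable_exponents :
    w.μ 2 0 < w.μ 3 0 ∧ 0 < w.μ 2 0 ∧ 0 < w.c + w.μ 2 0 ∧ 0 < w.c + w.μ 3 0 := by
  have h1 := w.abs_c_lt_gap
  have h2 := w.gap_lt
  have h3 := abs_le.1 (le_refl |w.c|)
  simp only [μ_zero_eq]
  refine ⟨?_, ?_, ?_, ?_⟩ <;> simp at h2 ⊢ <;> linarith [h3.1, h3.2]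

theorem continuous_μ (i : Fin 4) : Continuous (w.μ i) := by
  unfold μ exponent
  fin_cases i <;> simp <;> fun_prop

namespace IsAdaptedBasis

variable {w} {δ : ℝ} {u : Fin 4 → ℝ → ℝ → Phase} {η : Fin 4 → ℝ → Phase}
  (hu : w.IsAdaptedBasis δ u η)

include hu

theorem zero_mem : (0 : ℝ) ∈ Ici (-δ) := by
  have := hu.δ_pos
  simp; linarith

theorem solves_zero (i : Fin 4) (z : ℝ) :
    HasDerivAt (u i 0) (Matrix.mulVec (w.A 0 z) (u i 0 z)) z := hu.solves i 0 hu.zero_mem z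

theorem continuous_zero (i : Fin 4) : Continuous (u i 0) :=
  continuous_iff_continuousAt.2 fun z => (hu.solves_zero i z).continuousAt

theorem differentiableAt (i : Fin 4) (z : ℝ) : DifferentiableAt ℝ (fun lam => u i lam z) 0 := by
  have h : Ici (-δ) ∈ 𝓝 (0 : ℝ) := Ici_mem_nhds (by have := hu.δ_pos; linarith)
  exact ((hu.analytic i z 0 hu.zero_mem).differentiableWithinAt).differentiableAt
    (by rwa [insert_eq_of_mem hu.zero_mem])

theorem exists_bound_atTop {i : Fin 4} (hi : i = 0 ∨ i = 1) :
    ∃ C ≥ 0, ∀ lam ∈ Icc (-δ) δ, ∀ z ≥ 0, ‖u i lam z‖ ≤ C * Real.exp (w.μ i lam * z) := by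
  obtain ⟨L, hL⟩ := w.exists_norm_A_mulVec_le δ
  exact exists_norm_le_exp_of_tendstoUniformlyOn isCompact_Icc (w.continuous_μ i).continuousOn
    (fun z => (hu.analytic i z).continuousOn.mono Icc_subset_Ici_self)
    (hu.limit_atTop i hi _ Icc_subset_Ici_self isCompact_Icc) fun lam hlam =>
      w.norm_solution_le hL (abs_le.2 hlam) (hu.solves i lam (Icc_subset_Ici_self hlam))

theorem exists_bound_atBot {i : Fin 4} (hi : i = 2 ∨ i = 3) :
    ∃ C ≥ 0, ∀ lam ∈ Icc (-δ) δ, ∀ z ≤ 0, ‖u i lam z‖ ≤ C * Real.exp (w.μ i lam * z) := by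
  obtain ⟨L, hL⟩ := w.exists_norm_A_mulVec_le δ
  obtain ⟨C, hC, h⟩ := exists_norm_le_exp_of_tendstoUniformlyOn (U := fun lam z => u i lam (-z))
    (μ := fun lam => -w.μ i lam) (L := L) isCompact_Icc
    (w.continuous_μ i).neg.continuousOn
    (fun z => (hu.analytic i (-z)).continuousOn.mono Icc_subset_Ici_self)
    (tendstoUniformlyOn_comp_neg (hu.limit_atBot i hi _ Icc_subset_Ici_self isCompact_Icc))
    fun lam hlam s t => by
      have := w.norm_solution_le hL (abs_le.2 hlam) (hu.solves i lam (Icc_subset_Ici_self hlam))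
        (-s) (-t)
      rwa [show -t - -s = -(t - s) by ring, abs_neg] at this
  refine ⟨C, hC, fun lam hlam z hz => ?_⟩
  simpa using h lam hlam (-z) (by linarith)

theorem zero_mem_Icc : (0 : ℝ) ∈ Icc (-δ) δ := by
  have := hu.δ_pos
  constructor <;> linarith

theorem limit_zero_atTop {i : Fin 4} (hi : i = 0 ∨ i = 1) :
    Tendsto (fun z => Real.exp (-(w.μ i 0) * z) • u i 0 z) atTop (𝓝 (η i 0)) :=
  (hu.limit_atTop i hi _ Icc_subset_Ici_self isCompact_Icc).tendsto_at hu.zero_mem_Icc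

theorem limit_zero_atBot {i : Fin 4} (hi : i = 2 ∨ i = 3) :
    Tendsto (fun z => Real.exp (-(w.μ i 0) * z) • u i 0 z) atBot (𝓝 (η i 0)) :=
  (hu.limit_atBot i hi _ Icc_subset_Ici_self isCompact_Icc).tendsto_at hu.zero_mem_Icc

/-- `e^{cz} u_i(0,z)` decays exponentially at the end at which `u_i` is normalized. -/
theorem exists_weighted_bound_atTop {i : Fin 4} (hi : i = 0 ∨ i = 1) :
    ∃ C ≥ 0, ∃ κ < 0, ∀ z ≥ 0, Real.exp (w.c * z) * ‖u i 0 z‖ ≤ C * Real.exp (κ * z) := by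
  obtain ⟨C, hC, h⟩ := hu.exists_bound_atTop hi
  refine ⟨C, hC, w.c + w.μ i 0, ?_, fun z hz => ?_⟩
  · rcases hi with rfl | rfl
    exacts [w.stable_exponents.2.2.2, w.stable_exponents.2.2.1]
  · calc _ ≤ Real.exp (w.c * z) * (C * Real.exp (w.μ i 0 * z)) := by
          gcongr; exact h 0 hu.zero_mem_Icc z hz
      _ = _ := by rw [add_mul, Real.exp_add]; ring

theorem exists_weighted_bound_atBot {i : Fin 4} (hi : i = 2 ∨ i = 3) :
    ∃ C ≥ 0, ∃ κ > 0, ∀ z ≤ 0, Real.exp (w.c * z) * ‖u i 0 z‖ ≤ C * Real.exp (κ * z) := by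
  obtain ⟨C, hC, h⟩ := hu.exists_bound_atBot hi
  refine ⟨C, hC, w.c + w.μ i 0, ?_, fun z hz => ?_⟩
  · rcases hi with rfl | rfl
    exacts [w.unstable_exponents.2.2.1, w.unstable_exponents.2.2.2]
  · calc _ ≤ Real.exp (w.c * z) * (C * Real.exp (w.μ i 0 * z)) := by
          gcongr; exact h 0 hu.zero_mem_Icc z hz
      _ = _ := by rw [add_mul, Real.exp_add]; ring

end IsAdaptedBasis
end TravelingWave

/-! ### The derivative of the Evans function -/

/-- If `G(λ) = λ ∫ F(λ, t) dt` near `λ = 0`, with `F` dominated, then `G'(0) = ∫ F(0, t) dt`. -/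
theorem hasDerivAt_of_eq_mul_integral {s : Set ℝ} (hs : MeasurableSet s) {G : ℝ → ℝ}
    {F : ℝ → ℝ → ℝ} {bound : ℝ → ℝ} (hbound : IntegrableOn bound s)
    (hG : ∀ᶠ lam in 𝓝 (0 : ℝ), G lam = lam * ∫ t in s, F lam t)
    (hmeas : ∀ᶠ lam in 𝓝 (0 : ℝ), AEStronglyMeasurable (F lam) (volume.restrict s))
    (hF : ∀ᶠ lam in 𝓝 (0 : ℝ), ∀ t ∈ s, |F lam t| ≤ bound t)
    (hcont : ∀ t ∈ s, ContinuousAt (fun lam => F lam t) 0) :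
    HasDerivAt G (∫ t in s, F 0 t) 0 := by
  have h : Tendsto (fun lam => ∫ t in s, F lam t) (𝓝 0) (𝓝 (∫ t in s, F 0 t)) :=
    tendsto_integral_filter_of_dominated_convergence bound hmeas
      (hF.mono fun lam h => (ae_restrict_mem hs).mono fun t ht => h t ht) hbound
      ((ae_restrict_mem hs).mono fun t ht => hcont t ht)
  -- The slope of `G` at `0` is the integral itself, so continuity in `λ` suffices and nothing is
  -- differentiated under the integral sign.
  rw [hasDerivAt_iff_tendsto_slope]
  refine (h.mono_left nhdsWithin_le_nhds).congr' ?_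
  filter_upwards [hG.filter_mono nhdsWithin_le_nhds, self_mem_nhdsWithin] with lam h1 h2
  have h0 := hG.self_of_nhds
  rw [slope_def_field, h1, h0]
  field_simp [show lam ≠ 0 from h2]
  ring

namespace TravelingWave

variable {P : ActivatorInhibitorSystem} {w : TravelingWave P}

theorem continuous_diffForm (P : ActivatorInhibitorSystem) :
    Continuous fun p : Phase × Phase => P.diffForm p.1 p.2 := by
  simp only [ActivatorInhibitorSystem.diffForm]
  fun_prop

theorem abs_integrand_le (w : TravelingWave P) (u : Fin 4 → ℝ → ℝ → Phase) (i : Fin 4) (lam t : ℝ) :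
    |Real.exp (w.c * t) * P.diffForm (u i lam t) (u i 0 t)| ≤
      (1 / P.σ + 1 / P.α) * (Real.exp (w.c * t) * (‖u i lam t‖ * ‖u i 0 t‖)) := by
  rw [abs_mul, abs_of_pos (Real.exp_pos _)]
  calc _ ≤ Real.exp (w.c * t) * ((1 / P.σ + 1 / P.α) * (‖u i lam t‖ * ‖u i 0 t‖)) := by
        gcongr; exact P.abs_diffForm_le _ _
    _ = _ := by ring

namespace IsAdaptedBasis

variable {δ : ℝ} {u : Fin 4 → ℝ → ℝ → Phase} {η : Fin 4 → ℝ → Phase}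
  (hu : w.IsAdaptedBasis δ u η)

include hu

theorem u₂_zero_eq_u₃_zero (z : ℝ) : u 1 0 z = u 2 0 z := by rw [hu.u₂_eq, hu.u₃_eq]

theorem eventually_mem : ∀ᶠ lam in 𝓝 (0 : ℝ), lam ∈ Icc (-δ) δ := by
  have := hu.δ_pos
  exact Icc_mem_nhds (by linarith) this

theorem waveDensity_eq_one (t : ℝ) :
    w.waveDensity t = Real.exp (w.c * t) * P.diffForm (u 1 0 t) (u 1 0 t) := by
  rw [w.waveDensity_eq, hu.u₂_eq]

theorem exists_integrand_bound_atTop : ∃ B, ∀ lam ∈ Icc (-δ) δ, ∀ t ≥ 0,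
    Real.exp (w.c * t) * (‖u 1 lam t‖ * ‖u 1 0 t‖) ≤ B * Real.exp (-w.gap * t) := by
  obtain ⟨C, hC, h⟩ := hu.exists_bound_atTop (i := 1) (Or.inr rfl)
  refine ⟨C * C, fun lam hlam t ht => ?_⟩
  calc _ ≤ Real.exp (w.c * t) * ((C * Real.exp (w.μ 1 lam * t)) * (C * Real.exp (w.μ 1 0 * t))) := by
        gcongr
        exacts [h lam hlam t ht, h 0 hu.zero_mem_Icc t ht]
    _ = C * C * Real.exp ((w.c + w.μ 1 lam + w.μ 1 0) * t) := by
        rw [add_mul, add_mul, Real.exp_add, Real.exp_add]; ring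
    _ ≤ _ := by gcongr; exact w.c_add_μ_one_le lam

theorem exists_integrand_bound_atBot : ∃ B, ∀ lam ∈ Icc (-δ) δ, ∀ t ≤ 0,
    Real.exp (w.c * t) * (‖u 2 0 t‖ * ‖u 2 lam t‖) ≤ B * Real.exp (w.gap * t) := by
  obtain ⟨C, hC, h⟩ := hu.exists_bound_atBot (i := 2) (Or.inl rfl)
  refine ⟨C * C, fun lam hlam t ht => ?_⟩
  calc _ ≤ Real.exp (w.c * t) * ((C * Real.exp (w.μ 2 0 * t)) * (C * Real.exp (w.μ 2 lam * t))) := by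
        gcongr
        exacts [h 0 hu.zero_mem_Icc t ht, h lam hlam t ht]
    _ = C * C * Real.exp ((w.c + w.μ 2 lam + w.μ 2 0) * t) := by
        rw [add_mul, add_mul, Real.exp_add, Real.exp_add]; ring
    _ ≤ _ := by
        gcongr C * C * Real.exp ?_
        exact mul_le_mul_of_nonpos_right (w.le_c_add_μ_two lam) ht

theorem continuous_integrand (i : Fin 4) {lam : ℝ} (hlam : lam ∈ Icc (-δ) δ) :
    Continuous fun t => Real.exp (w.c * t) * P.diffForm (u i lam t) (u i 0 t) := by
  have h1 : Continuous (u i lam) := continuous_iff_continuousAt.2 fun z =>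
    (hu.solves i lam hlam.1 z).continuousAt
  have h2 := hu.continuous_zero i
  have := (continuous_diffForm P).comp (h1.prodMk h2)
  exact Continuous.mul (by fun_prop) this

theorem continuousAt_integrand (i : Fin 4) (t : ℝ) :
    ContinuousAt (fun lam => Real.exp (w.c * t) * P.diffForm (u i lam t) (u i 0 t)) 0 :=
  ((continuous_diffForm P).continuousAt.comp
    ((hu.differentiableAt i t).continuousAt.prodMk continuousAt_const)).const_mul _

theorem integrable_waveDensity : Integrable w.waveDensity := by
  have hσ := P.σ_pos
  have hα := P.α_pos
  rw [← integrableOn_univ, ← Iic_union_Ioi (a := (0 : ℝ))]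
  refine IntegrableOn.union ?_ ?_
  · obtain ⟨B, hB⟩ := hu.exists_integrand_bound_atBot
    have e : w.waveDensity = fun t => Real.exp (w.c * t) * P.diffForm (u 2 0 t) (u 2 0 t) :=
      funext fun t => by rw [hu.waveDensity_eq_one, hu.u₂_zero_eq_u₃_zero]
    rw [e]
    refine Integrable.mono' (((integrableOn_exp_mul_Iic w.gap_pos 0).const_mul B).const_mul
      (1 / P.σ + 1 / P.α)) (hu.continuous_integrand 2 hu.zero_mem_Icc).aestronglyMeasurable ?_
    filter_upwards [ae_restrict_mem measurableSet_Iic] with t ht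
    refine (w.abs_integrand_le u 2 0 t).trans ?_
    exact mul_le_mul_of_nonneg_left (hB 0 hu.zero_mem_Icc t ht) (by positivity)
  · obtain ⟨B, hB⟩ := hu.exists_integrand_bound_atTop
    rw [funext hu.waveDensity_eq_one]
    refine Integrable.mono' (((integrableOn_exp_mul_Ioi (neg_neg_of_pos w.gap_pos) 0).const_mul
      B).const_mul (1 / P.σ + 1 / P.α))
      (hu.continuous_integrand 1 hu.zero_mem_Icc).aestronglyMeasurable ?_
    filter_upwards [ae_restrict_mem measurableSet_Ioi] with t ht
    refine (w.abs_integrand_le u 1 0 t).trans ?_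
    exact mul_le_mul_of_nonneg_left (hB 0 hu.zero_mem_Icc t (le_of_lt ht)) (by positivity)

/-- Integrating the derivative of `Ω(u₂(λ), u₂(0))` from `0` to `∞`, where it vanishes, gives
`ω(u₂(λ), u₂(0)) = λ ∫ e^{ct} diffForm` at `z = 0`. -/
theorem hasDerivAt_omega_u₂ :
    HasDerivAt (fun lam => omega (u 1 lam 0) (u 1 0 0)) (∫ t in Ioi 0, w.waveDensity t) 0 := by
  have hσ := P.σ_pos
  have hα := P.α_pos
  obtain ⟨B, hB⟩ := hu.exists_integrand_bound_atTop
  have hint : IntegrableOn (fun t => (1 / P.σ + 1 / P.α) * (B * Real.exp (-w.gap * t))) (Ioi 0) :=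
    ((integrableOn_exp_mul_Ioi (neg_neg_of_pos w.gap_pos) 0).const_mul B).const_mul _
  have hdom : ∀ lam ∈ Icc (-δ) δ, ∀ t ∈ Ioi (0 : ℝ),
      |Real.exp (w.c * t) * P.diffForm (u 1 lam t) (u 1 0 t)| ≤
        (1 / P.σ + 1 / P.α) * (B * Real.exp (-w.gap * t)) := fun lam hlam t ht => by
    refine (w.abs_integrand_le u 1 lam t).trans ?_
    exact mul_le_mul_of_nonneg_left (hB lam hlam t (le_of_lt ht)) (by positivity)
  simp only [hu.waveDensity_eq_one]
  refine hasDerivAt_of_eq_mul_integral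
    (F := fun lam t => Real.exp (w.c * t) * P.diffForm (u 1 lam t) (u 1 0 t))
    measurableSet_Ioi hint (hu.eventually_mem.mono fun lam hlam => ?_)
    (hu.eventually_mem.mono fun lam hlam => (hu.continuous_integrand 1 hlam).aestronglyMeasurable)
    (hu.eventually_mem.mono hdom) (fun t _ => hu.continuousAt_integrand 1 t)
  have hi : IntegrableOn (fun t => Real.exp (w.c * t) * P.diffForm (u 1 lam t) (u 1 0 t)) (Ioi 0) :=
    Integrable.mono' hint (hu.continuous_integrand 1 hlam).aestronglyMeasurable
      ((ae_restrict_mem measurableSet_Ioi).mono (hdom lam hlam))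
  have hlim : Tendsto (fun t => w.bigOmega t (u 1 lam t) (u 1 0 t)) atTop (𝓝 0) := by
    have e : Tendsto (fun t => 4 * (B * Real.exp (-w.gap * t))) atTop (𝓝 0) := by
      have := (Real.tendsto_exp_atBot.comp
        ((tendsto_id (α := ℝ)).const_mul_atTop_of_neg (neg_neg_of_pos w.gap_pos)))
      simpa using (this.const_mul B).const_mul 4
    refine squeeze_zero_norm' ?_ e
    filter_upwards [eventually_ge_atTop 0] with t ht
    refine (w.abs_bigOmega_le t _ _).trans ?_
    exact mul_le_mul_of_nonneg_left (hB lam hlam t ht) (by positivity)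
  have := integral_Ioi_of_hasDerivAt_of_tendsto'
    (fun t _ => w.hasDerivAt_bigOmega (hu.solves 1 lam hlam.1 t) (hu.solves_zero 1 t))
    (by
      refine IntegrableOn.congr_fun (hi.const_mul (0 - lam)) (fun t _ => ?_) measurableSet_Ioi
      ring) hlim
  rw [bigOmega_zero] at this
  have e : ∀ t, Real.exp (w.c * t) * ((0 - lam) * P.diffForm (u 1 lam t) (u 1 0 t)) =
      (-lam) * (Real.exp (w.c * t) * P.diffForm (u 1 lam t) (u 1 0 t)) := fun t => by ring
  simp only [e, integral_const_mul] at this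
  linarith

/-- The mirror image on `(-∞, 0]`. The arguments of `ω` are exchanged, so that the integral enters
with the same sign. -/
theorem hasDerivAt_omega_u₃ :
    HasDerivAt (fun lam => omega (u 2 0 0) (u 2 lam 0)) (∫ t in Iic 0, w.waveDensity t) 0 := by
  have hσ := P.σ_pos
  have hα := P.α_pos
  obtain ⟨B, hB⟩ := hu.exists_integrand_bound_atBot
  have hint : IntegrableOn (fun t => (1 / P.σ + 1 / P.α) * (B * Real.exp (w.gap * t))) (Iic 0) :=
    ((integrableOn_exp_mul_Iic w.gap_pos 0).const_mul B).const_mul _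
  have hdom : ∀ lam ∈ Icc (-δ) δ, ∀ t ∈ Iic (0 : ℝ),
      |Real.exp (w.c * t) * P.diffForm (u 2 lam t) (u 2 0 t)| ≤
        (1 / P.σ + 1 / P.α) * (B * Real.exp (w.gap * t)) := fun lam hlam t ht => by
    refine (w.abs_integrand_le u 2 lam t).trans ?_
    rw [mul_comm ‖u 2 lam t‖]
    exact mul_le_mul_of_nonneg_left (hB lam hlam t ht) (by positivity)
  simp only [hu.waveDensity_eq_one, hu.u₂_zero_eq_u₃_zero]
  refine hasDerivAt_of_eq_mul_integral
    (F := fun lam t => Real.exp (w.c * t) * P.diffForm (u 2 lam t) (u 2 0 t))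
    measurableSet_Iic hint (hu.eventually_mem.mono fun lam hlam => ?_)
    (hu.eventually_mem.mono fun lam hlam => (hu.continuous_integrand 2 hlam).aestronglyMeasurable)
    (hu.eventually_mem.mono hdom) (fun t _ => hu.continuousAt_integrand 2 t)
  have hi : IntegrableOn (fun t => Real.exp (w.c * t) * P.diffForm (u 2 lam t) (u 2 0 t)) (Iic 0) :=
    Integrable.mono' hint (hu.continuous_integrand 2 hlam).aestronglyMeasurable
      ((ae_restrict_mem measurableSet_Iic).mono (hdom lam hlam))
  have hlim : Tendsto (fun t => w.bigOmega t (u 2 0 t) (u 2 lam t)) atBot (𝓝 0) := by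
    have e : Tendsto (fun t => 4 * (B * Real.exp (w.gap * t))) atBot (𝓝 0) := by
      have := (Real.tendsto_exp_atBot.comp ((tendsto_id (α := ℝ)).const_mul_atBot w.gap_pos))
      simpa using (this.const_mul B).const_mul 4
    refine squeeze_zero_norm' ?_ e
    filter_upwards [eventually_le_atBot 0] with t ht
    refine (w.abs_bigOmega_le t _ _).trans ?_
    exact mul_le_mul_of_nonneg_left (hB lam hlam t ht) (by positivity)
  have e : ∀ t, Real.exp (w.c * t) * ((lam - 0) * P.diffForm (u 2 0 t) (u 2 lam t)) =
      lam * (Real.exp (w.c * t) * P.diffForm (u 2 lam t) (u 2 0 t)) := fun t => by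
    simp only [ActivatorInhibitorSystem.diffForm]; ring
  have := integral_Iic_of_hasDerivAt_of_tendsto'
    (fun t _ => w.hasDerivAt_bigOmega (hu.solves_zero 2 t) (hu.solves 2 lam hlam.1 t))
    (by simp only [e]; exact hi.const_mul lam) hlim
  rw [bigOmega_zero] at this
  simp only [e, integral_const_mul] at this
  linarith

/-- `E^s(0, z)` is Lagrangian. -/
theorem omega_u₁_u₂ (z : ℝ) : omega (u 0 0 z) (u 1 0 z) = 0 := by
  obtain ⟨C, hC, h⟩ := hu.exists_bound_atTop (i := 1) (Or.inr rfl)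
  obtain ⟨B, hB, κ, hκ, h'⟩ := hu.exists_weighted_bound_atTop (i := 0) (Or.inl rfl)
  -- The weight is absorbed by `u₁` alone, and `u₂` is merely bounded; a constant with limit `0` is
  -- `0`.
  have lim : Tendsto (fun t => w.bigOmega t (u 0 0 t) (u 1 0 t)) atTop (𝓝 0) := by
    have e : Tendsto (fun t => 4 * (B * Real.exp (κ * t) * C)) atTop (𝓝 0) := by
      have := (Real.tendsto_exp_atBot.comp ((tendsto_id (α := ℝ)).const_mul_atTop_of_neg hκ))
      simpa using ((this.const_mul B).mul_const C).const_mul 4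
    refine squeeze_zero_norm' ?_ e
    filter_upwards [eventually_ge_atTop 0] with t ht
    refine (w.abs_bigOmega_le t _ _).trans ?_
    rw [← mul_assoc (Real.exp _)]
    refine mul_le_mul_of_nonneg_left (mul_le_mul (h' t ht) ?_ (norm_nonneg _) (by positivity))
      (by norm_num)
    refine (h 0 hu.zero_mem_Icc t ht).trans (mul_le_of_le_one_right hC (Real.exp_le_one_iff.2 ?_))
    exact mul_nonpos_of_nonpos_of_nonneg w.stable_exponents.2.1.le ht
  have hc := fun t => w.bigOmega_eq (hu.solves_zero 0) (hu.solves_zero 1) t z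
  simp only [hc] at lim
  have h2 := (tendsto_nhds_unique lim tendsto_const_nhds).symm
  rw [bigOmega, mul_eq_zero] at h2
  exact h2.resolve_left (Real.exp_pos _).ne'

/-- `E^u(0, z)` is Lagrangian. -/
theorem omega_u₃_u₄ (z : ℝ) : omega (u 2 0 z) (u 3 0 z) = 0 := by
  obtain ⟨C, hC, h⟩ := hu.exists_bound_atBot (i := 2) (Or.inl rfl)
  obtain ⟨B, hB, κ, hκ, h'⟩ := hu.exists_weighted_bound_atBot (i := 3) (Or.inr rfl)
  have lim : Tendsto (fun t => w.bigOmega t (u 2 0 t) (u 3 0 t)) atBot (𝓝 0) := by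
    have e : Tendsto (fun t => 4 * (B * Real.exp (κ * t) * C)) atBot (𝓝 0) := by
      have := (Real.tendsto_exp_atBot.comp ((tendsto_id (α := ℝ)).const_mul_atBot hκ))
      simpa using ((this.const_mul B).mul_const C).const_mul 4
    refine squeeze_zero_norm' ?_ e
    filter_upwards [eventually_le_atBot 0] with t ht
    refine (w.abs_bigOmega_le t _ _).trans ?_
    rw [mul_comm ‖u 2 0 t‖, ← mul_assoc (Real.exp _)]
    refine mul_le_mul_of_nonneg_left (mul_le_mul (h' t ht) ?_ (norm_nonneg _) (by positivity))
      (by norm_num)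
    refine (h 0 hu.zero_mem_Icc t ht).trans (mul_le_of_le_one_right hC (Real.exp_le_one_iff.2 ?_))
    exact mul_nonpos_of_nonneg_of_nonpos w.unstable_exponents.2.1.le ht
  have hc := fun t => w.bigOmega_eq (hu.solves_zero 2) (hu.solves_zero 3) t z
  simp only [hc] at lim
  have h2 := (tendsto_nhds_unique lim tendsto_const_nhds).symm
  rw [bigOmega, mul_eq_zero] at h2
  exact h2.resolve_left (Real.exp_pos _).ne'

/-- Every term of `detCols` is a product of two values of `ω`, each of which takes one factor
`e^{cz}` and becomes constant. This is why `D` does not depend on `z`. -/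
theorem evans_eq {lam : ℝ} (hlam : lam ∈ Ici (-δ)) (z : ℝ) :
    w.evans u z lam = detCols (u 0 lam 0) (u 1 lam 0) (u 2 lam 0) (u 3 lam 0) := by
  have h := fun i j => w.bigOmega_eq (hu.solves i lam hlam) (hu.solves j lam hlam) z 0
  simp only [bigOmega, mul_zero, Real.exp_zero, one_mul] at h
  rw [evans, det_of_columns]
  simp only [detCols, ← h]
  rw [show 2 * w.c * z = w.c * z + w.c * z by ring, Real.exp_add]
  ring

theorem lazutkinTreschev_eq (z : ℝ) : w.lazutkinTreschev u z = omega (u 0 0 0) (u 3 0 0) := by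
  rw [lazutkinTreschev, w.bigOmega_eq (hu.solves_zero 0) (hu.solves_zero 3) z 0, bigOmega_zero]

theorem hasDerivAt_evans (z : ℝ) :
    HasDerivAt (w.evans u z) (w.lazutkinTreschev u z * ∫ t, w.waveDensity t) 0 := by
  have hint := hu.integrable_waveDensity
  have hd := fun i => (hu.differentiableAt i 0).hasDerivAt
  have h := fun i j => (hd i).omega (hd j)
  have h12 : omega (u 0 0 0) (u 1 0 0) = 0 := hu.omega_u₁_u₂ 0
  have h34 : omega (u 2 0 0) (u 3 0 0) = 0 := hu.omega_u₃_u₄ 0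
  have e23 := hu.u₂_zero_eq_u₃_zero 0
  have k1 := hu.hasDerivAt_omega_u₂.unique ((hd 1).omega (hasDerivAt_const (0 : ℝ) (u 1 0 0)))
  have k2 := hu.hasDerivAt_omega_u₃.unique ((hasDerivAt_const (0 : ℝ) (u 2 0 0)).omega (hd 2))
  simp only [map_zero, add_zero, zero_add, LinearMap.zero_apply] at k1 k2
  have split : ∫ t, w.waveDensity t =
      (∫ t in Iic 0, w.waveDensity t) + ∫ t in Ioi 0, w.waveDensity t := by
    rw [← setIntegral_union (Iic_disjoint_Ioi le_rfl) measurableSet_Ioi hint.integrableOn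
      hint.integrableOn, Iic_union_Ioi, setIntegral_univ]
  have hD : HasDerivAt (fun lam => detCols (u 0 lam 0) (u 1 lam 0) (u 2 lam 0) (u 3 lam 0))
      (w.lazutkinTreschev u z * ∫ t, w.waveDensity t) 0 := by
    refine ((((h 0 1).mul (h 2 3)).sub ((h 0 2).mul (h 1 3))).add
      ((h 0 3).mul (h 1 2))).congr_deriv ?_
    -- With `u₂ = u₃` at `λ = 0`, the values `ω₁₂, ω₃₄, ω₁₃, ω₂₄, ω₂₃` all vanish, so the product
    -- rule leaves only `ω₁₄ ω₂₃'`. By `k1` and `k2` the two halves of `ω₂₃'` are the integrals over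
    -- the half-lines.
    rw [hu.lazutkinTreschev_eq, split, k1, k2]
    rw [← e23] at h34 ⊢
    rw [h12, h34, omega_self]
    ring
  refine hD.congr_of_eventuallyEq (hu.eventually_mem.mono fun lam hlam => ?_)
  exact hu.evans_eq hlam.1 z

end IsAdaptedBasis
end TravelingWave

/-! ### Intersections of Lagrangian planes and linear independence -/

theorem detCols_eq_zero_iff (a b c d : Phase) :
    detCols a b c d = 0 ↔ ∃ v : Fin 4 → ℝ, v ≠ 0 ∧ v 0 • a + v 1 • b + v 2 • c + v 3 • d = 0 := by
  have h := det_of_columns ![a, b, c, d]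
  simp only [Matrix.cons_val] at h
  rw [← h, ← Matrix.exists_mulVec_eq_zero_iff]
  refine exists_congr fun v => and_congr_right fun _ => ?_
  rw [show Matrix.mulVec (Matrix.of fun i j : Fin 4 => (![a, b, c, d] : Fin 4 → Phase) j i) v =
      v 0 • a + v 1 • b + v 2 • c + v 3 • d from ?_]
  ext i
  simp [Matrix.mulVec, dotProduct, Fin.sum_univ_four, mul_comm]

theorem span_inf_span_eq_bot_iff {a b c d : Phase} (hab : LinearIndependent ℝ ![a, b])
    (hcd : LinearIndependent ℝ ![c, d]) :
    Submodule.span ℝ {a, b} ⊓ Submodule.span ℝ {c, d} = ⊥ ↔ detCols a b c d ≠ 0 := by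
  rw [LinearIndependent.pair_iff] at hab hcd
  rw [← not_iff_not, ne_eq, not_not, detCols_eq_zero_iff, Submodule.eq_bot_iff, Iff.comm]
  refine ⟨?_, ?_⟩
  · rintro ⟨v, hv, h⟩ H
    apply hv
    have h1 := H (v 0 • a + v 1 • b) ⟨Submodule.mem_span_pair.2 ⟨_, _, rfl⟩,
      Submodule.mem_span_pair.2 ⟨-v 2, -v 3, by
        rw [add_assoc] at h; rw [eq_neg_of_add_eq_zero_left h]; module⟩⟩
    have h2 := hab _ _ h1
    rw [h1, zero_add] at h
    have h3 := hcd _ _ h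
    ext i; fin_cases i
    exacts [h2.1, h2.2, h3.1, h3.2]
  · intro H
    push Not at H
    obtain ⟨x, ⟨hx1, hx2⟩, hx⟩ := H
    obtain ⟨p, q, h1⟩ := Submodule.mem_span_pair.1 hx1
    obtain ⟨r, s, h2⟩ := Submodule.mem_span_pair.1 hx2
    refine ⟨![p, q, -r, -s], fun h0 => hx ?_, ?_⟩
    · have e0 := congrFun h0 0
      have e1 := congrFun h0 1
      simp at e0 e1
      rw [← h1, e0, e1]; simp
    · have : p • a + q • b = r • c + s • d := h1.trans h2.symm
      simp [this]

/-- The span of an isotropic pair is its own symplectic complement. -/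
theorem mem_span_pair_of_omega_eq_zero {a b x : Phase} (hab : LinearIndependent ℝ ![a, b])
    (h : omega a b = 0) (ha : omega a x = 0) (hb : omega b x = 0) :
    x ∈ Submodule.span ℝ {a, b} := by
  by_contra hx
  have hind := hab
  rw [LinearIndependent.pair_iff] at hab
  have hzero : ∀ y, y ∈ Submodule.span ℝ {a, b} ⊔ Submodule.span ℝ {x} := by
    intro y
    -- Each of the three terms of `detCols a b x y` contains one of the vanishing factors `ω(a,b)`,
    -- `ω(a,x)`, `ω(b,x)`. So every `y` depends on `a, b, x`, and then `a` is orthogonal to the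
    -- whole space.
    obtain ⟨v, hv, e⟩ := (detCols_eq_zero_iff a b x y).1 (by simp [detCols, h, ha, hb])
    have h3 : v 3 ≠ 0 := by
      intro h3
      rw [h3, zero_smul, add_zero] at e
      by_cases h2 : v 2 = 0
      · rw [h2, zero_smul, add_zero] at e
        have := hab _ _ e
        apply hv
        ext i; fin_cases i
        exacts [this.1, this.2, h2, h3]
      · apply hx
        refine Submodule.mem_span_pair.2 ⟨-(v 0 / v 2), -(v 1 / v 2), ?_⟩
        have e' : v 2 • x = -(v 0 • a + v 1 • b) := eq_neg_of_add_eq_zero_right e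
        have : x = (v 2)⁻¹ • (v 2 • x) := by rw [smul_smul, inv_mul_cancel₀ h2, one_smul]
        rw [this, e']
        module
    refine Submodule.mem_sup.2 ⟨_, Submodule.mem_span_pair.2 ⟨-(v 0 / v 3), -(v 1 / v 3), rfl⟩, _,
      Submodule.mem_span_singleton.2 ⟨-(v 2 / v 3), rfl⟩, ?_⟩
    have e' : v 3 • y = -(v 0 • a + v 1 • b + v 2 • x) := eq_neg_of_add_eq_zero_right e
    have : y = (v 3)⁻¹ • (v 3 • y) := by rw [smul_smul, inv_mul_cancel₀ h3, one_smul]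
    rw [this, e']
    module
  have h1 := hab 1 0
  have a0 : a = 0 := omega_nondegenerate fun y => by
    obtain ⟨s, hs, t, ht, rfl⟩ := Submodule.mem_sup.1 (hzero y)
    obtain ⟨p, q, rfl⟩ := Submodule.mem_span_pair.1 hs
    obtain ⟨r, rfl⟩ := Submodule.mem_span_singleton.1 ht
    simp [omega_self, h, ha]
  simp [a0] at h1

/-- Solutions with different exponents at one end are linearly independent. -/
theorem TravelingWave.linearIndependent_of_rates {P : ActivatorInhibitorSystem}
    (w : TravelingWave P) {lam : ℝ} {a b : ℝ → Phase}
    (ha : ∀ z, HasDerivAt a (Matrix.mulVec (w.A lam z) (a z)) z)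
    (hb : ∀ z, HasDerivAt b (Matrix.mulVec (w.A lam z) (b z)) z) {l : Filter ℝ} [l.NeBot]
    {μ μ' : ℝ} {ηa ηb : Phase} (hla : Tendsto (fun z => Real.exp (-μ * z) • a z) l (𝓝 ηa))
    (hlb : Tendsto (fun z => Real.exp (-μ' * z) • b z) l (𝓝 ηb)) (hηa : ηa ≠ 0) (hηb : ηb ≠ 0)
    (hμ : Tendsto (fun z => Real.exp ((μ - μ') * z)) l (𝓝 0)) (z : ℝ) :
    LinearIndependent ℝ ![a z, b z] := by
  rw [LinearIndependent.pair_iff]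
  intro x y hxy
  have hsol : ∀ t, x • a t + y • b t = 0 := fun t =>
    w.eq_zero_of_solution (a := fun t => x • a t + y • b t) (lam := lam)
      (fun t => (((ha t).const_smul x).add ((hb t).const_smul y)).congr_deriv
        (by simp only [Matrix.mulVec_add, Matrix.mulVec_smul])) hxy t
  -- Rescaling the relation at the rate of `b` makes the term with `a` disappear in the limit, so `y
  -- ηb = 0`; afterwards the rate of `a` gives `x = 0`.
  have h1 : Tendsto (fun t => x • Real.exp ((μ - μ') * t) • (Real.exp (-μ * t) • a t) +
      y • (Real.exp (-μ' * t) • b t)) l (𝓝 (x • (0 : ℝ) • ηa + y • ηb)) :=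
    ((hμ.smul hla).const_smul x).add (hlb.const_smul y)
  have h2 : ∀ t, x • Real.exp ((μ - μ') * t) • (Real.exp (-μ * t) • a t) +
      y • (Real.exp (-μ' * t) • b t) = 0 := fun t => by
    rw [smul_smul (Real.exp _), ← Real.exp_add, show (μ - μ') * t + -μ * t = -μ' * t by ring,
      smul_comm x, smul_comm y, ← smul_add, hsol, smul_zero]
  simp only [h2] at h1
  have h3 := tendsto_nhds_unique h1 tendsto_const_nhds
  simp only [zero_smul, smul_zero, zero_add] at h3
  have hy : y = 0 := (smul_eq_zero.1 h3).resolve_right hηb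
  refine ⟨?_, hy⟩
  have h4 : Tendsto (fun t => x • (Real.exp (-μ * t) • a t)) l (𝓝 (x • ηa)) := hla.const_smul x
  have h5 : ∀ t, x • (Real.exp (-μ * t) • a t) = 0 := fun t => by
    have := hsol t
    rw [hy, zero_smul, add_zero] at this
    rw [smul_comm, this, smul_zero]
  simp only [h5] at h4
  exact (smul_eq_zero.1 (tendsto_nhds_unique h4 tendsto_const_nhds)).resolve_right hηa

theorem tendsto_exp_mul_atTop {a : ℝ} (ha : a < 0) : Tendsto (fun t => Real.exp (a * t)) atTop (𝓝 0) :=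
  Real.tendsto_exp_atBot.comp ((tendsto_id (α := ℝ)).const_mul_atTop_of_neg ha)

theorem tendsto_exp_mul_atBot {a : ℝ} (ha : 0 < a) : Tendsto (fun t => Real.exp (a * t)) atBot (𝓝 0) :=
  Real.tendsto_exp_atBot.comp ((tendsto_id (α := ℝ)).const_mul_atBot ha)

namespace TravelingWave

variable {P : ActivatorInhibitorSystem} {w : TravelingWave P}

namespace IsAdaptedBasis

variable {δ : ℝ} {u : Fin 4 → ℝ → ℝ → Phase} {η : Fin 4 → ℝ → Phase}
  (hu : w.IsAdaptedBasis δ u η)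

include hu

theorem η_ne_zero (i : Fin 4) : η i 0 ≠ 0 := (hu.eigenvector i 0 hu.zero_mem).2

theorem linearIndependent_stable (z : ℝ) : LinearIndependent ℝ ![u 0 0 z, u 1 0 z] :=
  w.linearIndependent_of_rates (hu.solves_zero 0) (hu.solves_zero 1)
    (hu.limit_zero_atTop (Or.inl rfl)) (hu.limit_zero_atTop (Or.inr rfl)) (hu.η_ne_zero 0)
    (hu.η_ne_zero 1) (tendsto_exp_mul_atTop (sub_neg.2 w.stable_exponents.1)) z

theorem linearIndependent_unstable (z : ℝ) : LinearIndependent ℝ ![u 2 0 z, u 3 0 z] :=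
  LinearIndependent.pair_symm_iff.1 <|
  w.linearIndependent_of_rates (hu.solves_zero 3) (hu.solves_zero 2)
    (hu.limit_zero_atBot (Or.inr rfl)) (hu.limit_zero_atBot (Or.inl rfl)) (hu.η_ne_zero 3)
    (hu.η_ne_zero 2) (tendsto_exp_mul_atBot (sub_pos.2 w.unstable_exponents.1)) z

end IsAdaptedBasis
end TravelingWave

/-! ### Melnikov relations and transversality -/

/-- The facts on half-lines ending at `0` used below; the sign is `1` for `(-∞, 0]` and `-1` for `[0, ∞)`. -/
structure IsHalfLine (S : Set ℝ) (l : Filter ℝ) (sgn : ℝ) : Prop where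
  zero_mem : (0 : ℝ) ∈ S
  measurableSet : MeasurableSet S
  eventually_mem : ∀ᶠ t in l, t ∈ S
  exists_bound : ∀ ψ : ℝ → Phase, ContinuousOn ψ S → Tendsto ψ l (𝓝 0) → ∃ M, ∀ t ∈ S, ‖ψ t‖ ≤ M
  integral_eq : ∀ h h' : ℝ → ℝ, (∀ t ∈ S, HasDerivWithinAt h (h' t) S t) → IntegrableOn h' S →
    Tendsto h l (𝓝 0) → h 0 = sgn * ∫ t in S, h' t

theorem isHalfLine_Iic : IsHalfLine (Iic 0) atBot 1 where
  zero_mem := self_mem_Iic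
  measurableSet := measurableSet_Iic
  eventually_mem := eventually_le_atBot 0
  exists_bound ψ hψ h0 := by
    obtain ⟨Z, hZ⟩ := ((h0.norm.eventually_lt_const (u := 1) (by simp)).and
      (eventually_le_atBot 0)).exists_forall_of_atBot
    obtain ⟨B, hB⟩ := (isCompact_Icc (a := Z) (b := 0)).exists_bound_of_continuousOn
      (hψ.mono Icc_subset_Iic_self)
    refine ⟨max B 1, fun t ht => ?_⟩
    rcases le_total t Z with h | h
    · exact (hZ t h).1.le.trans (le_max_right _ _)
    · exact (hB t ⟨h, ht⟩).trans (le_max_left _ _)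
  integral_eq h h' hd hi h0 := by
    rw [integral_Iic_of_hasDerivAt_of_tendsto (hd 0 self_mem_Iic).continuousWithinAt
      (fun t ht => (hd t (mem_Iic.2 (le_of_lt ht))).hasDerivAt (Iic_mem_nhds ht)) hi h0]
    ring

theorem isHalfLine_Ici : IsHalfLine (Ici 0) atTop (-1) where
  zero_mem := self_mem_Ici
  measurableSet := measurableSet_Ici
  eventually_mem := eventually_ge_atTop 0
  exists_bound ψ hψ h0 := by
    obtain ⟨Z, hZ⟩ := ((h0.norm.eventually_lt_const (u := 1) (by simp)).and
      (eventually_ge_atTop 0)).exists_forall_of_atTop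
    obtain ⟨B, hB⟩ := (isCompact_Icc (a := 0) (b := Z)).exists_bound_of_continuousOn
      (hψ.mono Icc_subset_Ici_self)
    refine ⟨max B 1, fun t ht => ?_⟩
    rcases le_total t Z with h | h
    · exact (hB t ⟨ht, h⟩).trans (le_max_left _ _)
    · exact (hZ t h).1.le.trans (le_max_right _ _)
  integral_eq h h' hd hi h0 := by
    rw [integral_Ici_eq_integral_Ioi,
      integral_Ioi_of_hasDerivAt_of_tendsto (hd 0 self_mem_Ici).continuousWithinAt
      (fun t ht => (hd t (mem_Ici.2 (le_of_lt ht))).hasDerivAt (Ici_mem_nhds ht))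
      (hi.mono_set Ioi_subset_Ici_self) h0]
    ring

namespace ActivatorInhibitorSystem

variable (P : ActivatorInhibitorSystem)

/-- The derivative of the vector field with respect to the wave speed. -/
def speedDeriv (p : Phase) : Phase := ![0, 0, -p 2, -p 3]

theorem hasDerivAt_vectorField {ψ : ℝ → Phase} {k : ℝ → ℝ} {y : Phase} {κ s : ℝ}
    (hψ : HasDerivAt ψ y s) (hk : HasDerivAt k κ s) :
    HasDerivAt (fun s => P.vectorField (k s) (ψ s))
      (Matrix.mulVec (P.coeffMatrix (k s) 0 (ψ s)) y + κ • speedDeriv (ψ s)) s := by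
  have hψ := hasDerivAt_pi.1 hψ
  have hf : HasDerivAt (fun s => P.f (ψ s 0)) (deriv P.f (ψ s 0) * y 0) s :=
    ((P.f_contDiff.differentiable (by norm_num) _).hasDerivAt).comp s (hψ 0)
  have hg : HasDerivAt (fun s => P.g (ψ s 1)) (deriv P.g (ψ s 1) * y 1) s :=
    ((P.g_contDiff.differentiable (by norm_num) _).hasDerivAt).comp s (hψ 1)
  rw [hasDerivAt_pi]
  intro i
  simp only [coeffMatrix_mulVec, vectorField, speedDeriv]
  fin_cases i
  · simpa using (hψ 2).const_mul P.σ
  · simpa using (hψ 3).const_mul P.α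
  · refine ((((hk.neg.mul (hψ 2)).sub (hf.div_const P.σ)).add (hψ 1))).congr_deriv ?_
    simp; ring
  · refine ((((hk.neg.mul (hψ 3)).sub (hψ 0)).sub (hg.div_const P.α))).congr_deriv ?_
    simp; ring

theorem contDiff_vectorField : ContDiff ℝ 1 fun q : Phase × ℝ => P.vectorField q.2 q.1 := by
  have hf : ContDiff ℝ 1 P.f := P.f_contDiff.of_le (by norm_num)
  have hg : ContDiff ℝ 1 P.g := P.g_contDiff.of_le (by norm_num)
  rw [contDiff_pi]
  intro i
  have hp : ∀ i : Fin 4, ContDiff ℝ 1 fun q : Phase × ℝ => q.1 i := fun i =>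
    (contDiff_apply ℝ ℝ i).comp contDiff_fst
  have h0 := hp 0
  have h1 := hp 1
  have h2 := hp 2
  have h3 := hp 3
  have h4 : ContDiff ℝ 1 fun q : Phase × ℝ => q.2 := contDiff_snd
  have hf0 := hf.comp h0
  have hg0 := hg.comp h1
  simp only [vectorField]
  fin_cases i
  · exact contDiff_const.mul h2
  · exact contDiff_const.mul h3
  · exact ((h4.neg.mul h2).sub (hf0.div_const P.σ)).add h1
  · exact ((h4.neg.mul h3).sub h0).sub (hg0.div_const P.α)

theorem exists_lipschitz_vectorField (R : ℝ) : ∃ L : NNReal, ∀ p q : Phase × ℝ, ‖p‖ ≤ R → ‖q‖ ≤ R →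
    ‖P.vectorField p.2 p.1 - P.vectorField q.2 q.1‖ ≤ L * ‖p - q‖ := by
  have h := P.contDiff_vectorField
  obtain ⟨C, hC⟩ := (isCompact_closedBall (0 : Phase × ℝ) R).exists_bound_of_continuousOn
    (h.continuous_fderiv one_ne_zero).continuousOn
  have := (convex_closedBall (0 : Phase × ℝ) R).lipschitzOnWith_of_nnnorm_fderiv_le (𝕜 := ℝ)
    (f := fun q : Phase × ℝ => P.vectorField q.2 q.1) (C := C.toNNReal)
    (fun x _ => h.differentiable one_ne_zero x)
    (fun x hx => by
      rw [← NNReal.coe_le_coe]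
      exact (hC x hx).trans (Real.le_coe_toNNReal C))
  refine ⟨C.toNNReal, fun p q hp hq => ?_⟩
  exact this.norm_sub_le (mem_closedBall_zero_iff.2 hp) (mem_closedBall_zero_iff.2 hq)

end ActivatorInhibitorSystem

namespace TravelingWave

variable {P : ActivatorInhibitorSystem} {w : TravelingWave P}

theorem continuous_vectorField (P : ActivatorInhibitorSystem) (k : ℝ) :
    Continuous (P.vectorField k) :=
  P.contDiff_vectorField.continuous.comp (Continuous.prodMk_left k)

/-- A one-parameter family of orbits through `(φ, c)` as in `tangentVectors`, with velocity
`(Y, κ)`. -/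
structure IsVariation (w : TravelingWave P) (S : Set ℝ) (l : Filter ℝ) (Ψ : ℝ → ℝ → Phase)
    (k : ℝ → ℝ) (Y : ℝ → Phase) (κ : ℝ) : Prop where
  orbit : ∀ s, (Ψ s, k s) ∈ P.asymptoticOrbits S l
  base : ∀ t ∈ S, Ψ 0 t = w.φ t
  speed : k 0 = w.c
  uniform : ∀ ε > 0, ∀ᶠ s in 𝓝 (0 : ℝ), ∀ t ∈ S, ‖Ψ s t - Ψ 0 t - s • Y t‖ ≤ ε * |s|
  hasDerivAt_speed : HasDerivAt k κ 0

/-- The difference quotient of a family of orbits. -/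
def orbitQuotient (w : TravelingWave P) (Ψ : ℝ → ℝ → Phase) (s t : ℝ) : Phase :=
  s⁻¹ • (Ψ s t - w.φ t)

/-- The difference quotient of the velocities of a family of orbits. -/
def fieldQuotient (w : TravelingWave P) (Ψ : ℝ → ℝ → Phase) (k : ℝ → ℝ) (s t : ℝ) : Phase :=
  s⁻¹ • (P.vectorField (k s) (Ψ s t) - P.vectorField w.c (w.φ t))

/-- The inhomogeneity in the variational equation satisfied by `orbitQuotient`. -/
def remainder (w : TravelingWave P) (Ψ : ℝ → ℝ → Phase) (k : ℝ → ℝ) (s t : ℝ) : Phase :=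
  w.fieldQuotient Ψ k s t - Matrix.mulVec (w.A 0 t) (w.orbitQuotient Ψ s t)

namespace IsVariation

variable {S : Set ℝ} {l : Filter ℝ} {sgn : ℝ} {Ψ : ℝ → ℝ → Phase} {k : ℝ → ℝ} {Y : ℝ → Phase}
  {κ : ℝ} (hΨ : w.IsVariation S l Ψ k Y κ)

include hΨ

theorem continuousOn_orbit (s : ℝ) : ContinuousOn (Ψ s) S := fun t ht =>
  ((hΨ.orbit s).1 t ht).continuousWithinAt

/-- One nonzero `s` in the uniform estimate is enough: `s • Y` differs by a bounded amount from a
difference of two orbits that are bounded on `S`. -/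
theorem exists_velocity_bound (hS : IsHalfLine S l sgn) : ∃ N ≥ 0, ∀ t ∈ S, ‖Y t‖ ≤ N := by
  have hbd : ∀ s, ∃ M, ∀ t ∈ S, ‖Ψ s t‖ ≤ M := fun s =>
    hS.exists_bound _ (hΨ.continuousOn_orbit s) (hΨ.orbit s).2
  obtain ⟨s, hs, hs0⟩ :=
    (((hΨ.uniform 1 one_pos).filter_mono nhdsWithin_le_nhds).and
      (self_mem_nhdsWithin (s := ({0}ᶜ : Set ℝ)) (a := 0))).exists
  have hs0 : s ≠ 0 := hs0
  obtain ⟨M₁, h1⟩ := hbd s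
  obtain ⟨M₂, h2⟩ := hbd 0
  refine ⟨max (|s|⁻¹ * (M₁ + M₂ + |s|)) 0, le_max_right _ _, fun t ht =>
    le_trans ?_ (le_max_left _ _)⟩
  have h3 : ‖s • Y t‖ ≤ M₁ + M₂ + |s| := by
    have e : s • Y t = Ψ s t - Ψ 0 t - (Ψ s t - Ψ 0 t - s • Y t) := by abel
    rw [e]
    refine (norm_sub_le _ _).trans (add_le_add ((norm_sub_le _ _).trans
      (add_le_add (h1 t ht) (h2 t ht))) ?_)
    simpa using hs t ht
  rw [norm_smul, Real.norm_eq_abs] at h3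
  rw [inv_mul_eq_div, le_div_iff₀ (abs_pos.2 hs0), mul_comm]
  exact h3

/-- The uniform differentiability bounds the difference quotients; the local Lipschitz constant of
the vector field then bounds those of the velocities, hence the remainders. These bounds are the
domination as `s → 0`. -/
theorem exists_eventually_bound (hS : IsHalfLine S l sgn) : ∃ B ≥ 0, ∀ᶠ s in 𝓝[≠] (0 : ℝ),
    ∀ t ∈ S, ‖w.orbitQuotient Ψ s t‖ ≤ B ∧ ‖w.remainder Ψ k s t‖ ≤ B := by
  obtain ⟨N, hN0, hN⟩ := hΨ.exists_velocity_bound hS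
  obtain ⟨M, -, hM⟩ := w.exists_norm_φ_le
  obtain ⟨C, hC0, hC⟩ := hΨ.hasDerivAt_speed.isBigO_sub.exists_nonneg
  obtain ⟨LA, hLA⟩ := w.exists_norm_A_mulVec_le 0
  -- The radius makes the ball contain all `(Ψ s t, k s)` and `(φ t, c)` for `t ∈ S` and small `s`
  -- with `|s| ≤ 1`.
  obtain ⟨L, hL⟩ := P.exists_lipschitz_vectorField (max (M + (N + 1)) (|w.c| + C))
  refine ⟨max (N + 1) (L * (N + 1 + C) + LA * (N + 1)),
    le_max_of_le_left (by linarith), ?_⟩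
  have e1 : ∀ᶠ s in 𝓝[≠] (0 : ℝ), |s| ≤ 1 := nhdsWithin_le_nhds <| by
    filter_upwards [Icc_mem_nhds (show (-1 : ℝ) < 0 by norm_num) one_pos] with s hs
    exact abs_le.2 hs
  filter_upwards [(hΨ.uniform 1 one_pos).filter_mono nhdsWithin_le_nhds,
    hC.bound.filter_mono nhdsWithin_le_nhds, e1,
    self_mem_nhdsWithin (s := ({0}ᶜ : Set ℝ)) (a := 0)] with s h1 h2 h3 h4 t ht
  have hs0 : 0 < |s| := abs_pos.2 h4
  have d1 : ‖Ψ s t - w.φ t‖ ≤ (N + 1) * |s| := by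
    have e : Ψ s t - w.φ t = (Ψ s t - Ψ 0 t - s • Y t) + s • Y t := by rw [hΨ.base t ht]; abel
    rw [e]
    refine (norm_add_le _ _).trans ?_
    rw [norm_smul, Real.norm_eq_abs]
    nlinarith [h1 t ht, hN t ht]
  have d2 : |k s - w.c| ≤ C * |s| := by simpa [hΨ.speed] using h2
  have d3 : ‖w.orbitQuotient Ψ s t‖ ≤ N + 1 := by
    rw [orbitQuotient, norm_smul, norm_inv, Real.norm_eq_abs, inv_mul_eq_div, div_le_iff₀ hs0]
    exact d1
  have d4 : ‖w.fieldQuotient Ψ k s t‖ ≤ L * (N + 1 + C) := by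
    rw [fieldQuotient, norm_smul, norm_inv, Real.norm_eq_abs, inv_mul_eq_div, div_le_iff₀ hs0]
    refine (hL (Ψ s t, k s) (w.φ t, w.c) ?_ ?_).trans ?_
    · refine max_le_max ?_ ?_
      · have h5 : ‖w.φ t - Ψ s t‖ ≤ N + 1 := by
          rw [norm_sub_rev]; nlinarith
        exact (norm_le_norm_add_norm_sub (w.φ t) (Ψ s t)).trans (add_le_add (hM t)
          ((norm_sub_rev _ _).trans_le ((norm_sub_rev _ _).trans_le h5)))
      · have := abs_sub_abs_le_abs_sub (k s) w.c
        simp only [Real.norm_eq_abs]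
        nlinarith
    · refine max_le_max ?_ ?_
      · simp only; linarith [hM t]
      · simp only [Real.norm_eq_abs]; linarith
    · rw [mul_assoc]
      refine mul_le_mul_of_nonneg_left ?_ L.2
      rw [Prod.mk_sub_mk, Prod.norm_mk]
      refine max_le ?_ ?_
      · nlinarith
      · rw [Real.norm_eq_abs]; nlinarith
  refine ⟨d3.trans (le_max_left _ _), le_trans ?_ (le_max_right _ _)⟩
  exact (norm_sub_le _ _).trans (add_le_add d4 ((hLA 0 (by simp) t _).trans
    (mul_le_mul_of_nonneg_left d3 LA.2)))

/-- For each fixed `s` the quotient solves `Q' = A Q + R` exactly, and the part `A Q` drops out of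
the derivative of `Ω`. Working with quotients avoids having to show that the limit `Y` is
differentiable in `t`. -/
theorem hasDerivWithinAt_bigOmega_orbitQuotient {a : ℝ → Phase}
    (ha : ∀ z, HasDerivAt a (Matrix.mulVec (w.A 0 z) (a z)) z) (s : ℝ) {t : ℝ} (ht : t ∈ S) :
    HasDerivWithinAt (fun t => w.bigOmega t (a t) (w.orbitQuotient Ψ s t))
      (w.bigOmega t (a t) (w.remainder Ψ k s t)) S t := by
  have h1 : HasDerivWithinAt (w.orbitQuotient Ψ s) (w.fieldQuotient Ψ k s t) S t :=
    (((hΨ.orbit s).1 t ht).sub (w.solves t).hasDerivWithinAt).const_smul s⁻¹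
  refine (w.hasDerivWithinAt_bigOmega (ha t).hasDerivWithinAt h1).congr_deriv ?_
  have := P.omega_coeffMatrix w.c 0 0 (w.φ t) (a t) (w.orbitQuotient Ψ s t)
  simp only [remainder, map_sub, A, bigOmega]
  linear_combination Real.exp (w.c * t) * this

theorem continuousOn_remainder (s : ℝ) : ContinuousOn (w.remainder Ψ k s) S := by
  have c0 := hΨ.continuousOn_orbit s
  have h1 : ContinuousOn (fun t => w.orbitQuotient Ψ s t) S := by
    simp only [orbitQuotient]
    exact (c0.sub w.φ_continuous.continuousOn).const_smul s⁻¹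
  have h2 : ContinuousOn (fun t => P.vectorField (k s) (Ψ s t)) S :=
    (continuous_vectorField P (k s)).comp_continuousOn c0
  have h3 : ContinuousOn (fun t => P.vectorField w.c (w.φ t)) S :=
    ((continuous_vectorField P w.c).comp w.φ_continuous).continuousOn
  have h4 : ContinuousOn (fun t => Matrix.mulVec (w.A 0 t) (w.orbitQuotient Ψ s t)) S :=
    (w.continuous_A_mulVec 0).comp_continuousOn
      (f := fun t => (t, w.orbitQuotient Ψ s t)) (continuousOn_id.prodMk h1)
  unfold remainder fieldQuotient
  exact ((h2.sub h3).const_smul s⁻¹).sub h4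

theorem hasDerivAt_orbit {t : ℝ} (ht : t ∈ S) : HasDerivAt (fun s => Ψ s t) (Y t) 0 := by
  rw [hasDerivAt_iff_isLittleO, Asymptotics.isLittleO_iff]
  intro ε hε
  filter_upwards [hΨ.uniform ε hε] with s hs
  simpa using hs t ht

theorem tendsto_orbitQuotient {t : ℝ} (ht : t ∈ S) :
    Tendsto (fun s => w.orbitQuotient Ψ s t) (𝓝[≠] 0) (𝓝 (Y t)) := by
  refine (hasDerivAt_iff_tendsto_slope.1 (hΨ.hasDerivAt_orbit ht)).congr fun s => ?_
  rw [slope, vsub_eq_sub, hΨ.base t ht, sub_zero, orbitQuotient]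

/-- The derivative of the vector field along the family is `A Y` plus `κ` times its derivative in
the speed; `remainder` subtracts the first part. -/
theorem tendsto_remainder {t : ℝ} (ht : t ∈ S) :
    Tendsto (fun s => w.remainder Ψ k s t) (𝓝[≠] 0)
      (𝓝 (κ • ActivatorInhibitorSystem.speedDeriv (w.φ t))) := by
  have h1 := hasDerivAt_iff_tendsto_slope.1
    (P.hasDerivAt_vectorField (hΨ.hasDerivAt_orbit ht) hΨ.hasDerivAt_speed)
  have h2 : Tendsto (fun s => w.fieldQuotient Ψ k s t) (𝓝[≠] 0)
      (𝓝 (Matrix.mulVec (w.A 0 t) (Y t) +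
        κ • ActivatorInhibitorSystem.speedDeriv (w.φ t))) := by
    rw [hΨ.base t ht, hΨ.speed] at h1
    refine h1.congr fun s => ?_
    rw [slope, vsub_eq_sub, hΨ.base t ht, hΨ.speed, sub_zero, fieldQuotient]
  have h3 : Tendsto (fun s => Matrix.mulVec (w.A 0 t) (w.orbitQuotient Ψ s t)) (𝓝[≠] 0)
      (𝓝 (Matrix.mulVec (w.A 0 t) (Y t))) :=
    (((w.continuous_A_mulVec 0).comp (Continuous.prodMk_right t)).tendsto _).comp
      (hΨ.tendsto_orbitQuotient ht)
  have h4 := h2.sub h3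
  rwa [add_sub_cancel_left] at h4

/-- A solution `a` of the variational equation for which `e^{cz} a` is integrable on a half-line
determines a linear relation satisfied by the velocities of all variations. -/
theorem omega_velocity (hS : IsHalfLine S l sgn)
    {a : ℝ → Phase} (ha : ∀ z, HasDerivAt a (Matrix.mulVec (w.A 0 z) (a z)) z) {b : ℝ → ℝ}
    (hb : ∀ t ∈ S, Real.exp (w.c * t) * ‖a t‖ ≤ b t) (hbi : IntegrableOn b S)
    (hb0 : Tendsto b l (𝓝 0)) :
    omega (a 0) (Y 0) = κ * (sgn * ∫ t in S,
      w.bigOmega t (a t) (ActivatorInhibitorSystem.speedDeriv (w.φ t))) := by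
  obtain ⟨B, hB0, hB⟩ := hΨ.exists_eventually_bound hS
  have bound : ∀ t ∈ S, ∀ y : Phase, ‖y‖ ≤ B → ‖w.bigOmega t (a t) y‖ ≤ 4 * (b t * B) :=
    fun t ht y hy => by
      refine (w.abs_bigOmega_le t _ _).trans ?_
      rw [← mul_assoc (Real.exp _)]
      have h1 := hb t ht
      exact mul_le_mul_of_nonneg_left (mul_le_mul h1 hy (norm_nonneg _)
        (le_trans (by positivity) h1)) (by norm_num)
  have hint : IntegrableOn (fun t => 4 * (b t * B)) S := (hbi.mul_const B).const_mul 4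
  have hac : Continuous a := continuous_iff_continuousAt.2 fun z => (ha z).continuousAt
  have hmeas : ∀ s, AEStronglyMeasurable (fun t => w.bigOmega t (a t) (w.remainder Ψ k s t))
      (volume.restrict S) := fun s =>
    (ContinuousOn.mul (by fun_prop) (continuous_omega.comp_continuousOn
      (hac.continuousOn.prodMk (hΨ.continuousOn_remainder s)))).aestronglyMeasurable
      hS.measurableSet
  have hlim : ∀ t ∈ S, Tendsto (fun s => w.bigOmega t (a t) (w.remainder Ψ k s t)) (𝓝[≠] 0)
      (𝓝 (w.bigOmega t (a t) (κ • ActivatorInhibitorSystem.speedDeriv (w.φ t)))) := fun t ht =>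
    ((continuous_omega.tendsto _).comp
      (tendsto_const_nhds.prodMk_nhds (hΨ.tendsto_remainder ht))).const_mul _
  have hI : Tendsto (fun s => ∫ t in S, w.bigOmega t (a t) (w.remainder Ψ k s t)) (𝓝[≠] 0)
      (𝓝 (∫ t in S, w.bigOmega t (a t) (κ • ActivatorInhibitorSystem.speedDeriv (w.φ t)))) :=
    tendsto_integral_filter_of_dominated_convergence _ (Eventually.of_forall hmeas)
      (hB.mono fun s hs => (ae_restrict_mem hS.measurableSet).mono fun t ht =>
        bound t ht _ (hs t ht).2) hint
      ((ae_restrict_mem hS.measurableSet).mono hlim)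
  -- The fundamental theorem on the half-line for fixed `s`: the boundary term at infinity vanishes
  -- because `e^{ct} a` tends to `0` and the quotient is bounded. Letting `s → 0` on both sides
  -- gives the claim.
  have hval : ∀ᶠ s in 𝓝[≠] (0 : ℝ),
      sgn * (∫ t in S, w.bigOmega t (a t) (w.remainder Ψ k s t)) =
        omega (a 0) (w.orbitQuotient Ψ s 0) := by
    filter_upwards [hB] with s h1
    rw [← bigOmega_zero w]
    refine (hS.integral_eq (fun t => w.bigOmega t (a t) (w.orbitQuotient Ψ s t)) _
      (fun t ht => hΨ.hasDerivWithinAt_bigOmega_orbitQuotient ha s ht)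
      (Integrable.mono' hint (hmeas s) ((ae_restrict_mem hS.measurableSet).mono fun t ht =>
        bound t ht _ (h1 t ht).2)) ?_).symm
    have e : Tendsto (fun t => 4 * (b t * B)) l (𝓝 0) := by
      simpa using (hb0.mul_const B).const_mul 4
    exact squeeze_zero_norm' (hS.eventually_mem.mono fun t ht => bound t ht _ (h1 t ht).1) e
  have hlim0 := (continuous_omega.tendsto _).comp
    ((tendsto_const_nhds (x := a 0)).prodMk_nhds (hΨ.tendsto_orbitQuotient hS.zero_mem))
  have h := tendsto_nhds_unique hlim0 ((hI.const_mul sgn).congr' hval)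
  have e : ∀ t, w.bigOmega t (a t) (κ • ActivatorInhibitorSystem.speedDeriv (w.φ t)) =
      κ * w.bigOmega t (a t) (ActivatorInhibitorSystem.speedDeriv (w.φ t)) := fun t => by
    simp only [bigOmega, map_smul, smul_eq_mul]; ring
  simp only [e, integral_const_mul] at h
  exact h.trans (by ring)

end IsVariation

theorem omega_tangentVectors {S : Set ℝ} {l : Filter ℝ} {sgn : ℝ} (hS : IsHalfLine S l sgn)
    {a : ℝ → Phase} (ha : ∀ z, HasDerivAt a (Matrix.mulVec (w.A 0 z) (a z)) z) {b : ℝ → ℝ}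
    (hb : ∀ t ∈ S, Real.exp (w.c * t) * ‖a t‖ ≤ b t) (hbi : IntegrableOn b S)
    (hb0 : Tendsto b l (𝓝 0)) {x : Phase × ℝ} (hx : x ∈ P.tangentVectors w.c w.φ S l 0) :
    omega (a 0) x.1 = x.2 * (sgn * ∫ t in S,
      w.bigOmega t (a t) (ActivatorInhibitorSystem.speedDeriv (w.φ t))) := by
  obtain ⟨Ψ, k, Y, horb, h0, hk0, hunif, hk, hY⟩ := hx
  rw [← hY]
  exact IsVariation.omega_velocity ⟨horb, h0, hk0, hunif, hk⟩ hS ha hb hbi hb0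

namespace IsAdaptedBasis

variable {δ : ℝ} {u : Fin 4 → ℝ → ℝ → Phase} {η : Fin 4 → ℝ → Phase}
  (hu : w.IsAdaptedBasis δ u η)

include hu

/-- The Melnikov integral depends only on the solution, not on the tangent vector, so the relation
is linear and passes from velocities to their span. -/
theorem exists_omega_centerUnstable {i : Fin 4} (hi : i = 2 ∨ i = 3) :
    ∃ m, ∀ x ∈ P.tangentCenterUnstable w.c w.φ 0, omega (u i 0 0) x.1 = m * x.2 := by
  obtain ⟨C, -, κ, hκ, h⟩ := hu.exists_weighted_bound_atBot hi
  refine ⟨1 * ∫ t in Iic 0,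
      w.bigOmega t (u i 0 t) (ActivatorInhibitorSystem.speedDeriv (w.φ t)), fun x hx => ?_⟩
  refine Submodule.span_induction (fun x hx => ?_) (by simp) (fun x y _ _ hx hy => ?_)
    (fun r x _ hx => ?_) hx
  · rw [mul_comm]
    exact omega_tangentVectors isHalfLine_Iic (hu.solves_zero i) (fun t ht => h t ht)
      ((integrableOn_exp_mul_Iic hκ 0).const_mul C)
      (by simpa using (tendsto_exp_mul_atBot hκ).const_mul C) hx
  · simp only [Prod.fst_add, Prod.snd_add, map_add, hx, hy, mul_add]
  · simp only [Prod.smul_fst, Prod.smul_snd, map_smul, hx, smul_eq_mul]; ring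

theorem exists_omega_centerStable {i : Fin 4} (hi : i = 0 ∨ i = 1) :
    ∃ m, ∀ x ∈ P.tangentCenterStable w.c w.φ 0, omega (u i 0 0) x.1 = m * x.2 := by
  obtain ⟨C, -, κ, hκ, h⟩ := hu.exists_weighted_bound_atTop hi
  refine ⟨(-1) * ∫ t in Ici 0,
      w.bigOmega t (u i 0 t) (ActivatorInhibitorSystem.speedDeriv (w.φ t)), fun x hx => ?_⟩
  refine Submodule.span_induction (fun x hx => ?_) (by simp) (fun x y _ _ hx hy => ?_)
    (fun r x _ hx => ?_) hx
  · rw [mul_comm]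
    exact omega_tangentVectors isHalfLine_Ici (hu.solves_zero i) (fun t ht => h t ht)
      ((integrableOn_Ici_iff_integrableOn_Ioi (by simp)).2 ((integrableOn_exp_mul_Ioi hκ 0).const_mul C))
      (by simpa using (tendsto_exp_mul_atTop hκ).const_mul C) hx
  · simp only [Prod.fst_add, Prod.snd_add, map_add, hx, hy, mul_add]
  · simp only [Prod.smul_fst, Prod.smul_snd, map_smul, hx, smul_eq_mul]; ring

/-- Transversality makes the Lazutkin-Treschev invariant nonzero. -/
theorem omega_u₁_u₄_ne_zero : omega (u 0 0 0) (u 3 0 0) ≠ 0 := by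
  intro h14
  have hind := LinearIndependent.pair_iff.1 (hu.linearIndependent_unstable 0)
  have h24 : omega (u 1 0 0) (u 3 0 0) = 0 := by
    rw [hu.u₂_zero_eq_u₃_zero]; exact hu.omega_u₃_u₄ 0
  -- `u₄` is orthogonal to `u₁` by assumption and to `u₂ = u₃` by the Lagrangian property of `E^u`,
  -- so it lies in `E^s`.
  obtain ⟨p, q, hpq⟩ := Submodule.mem_span_pair.1 (mem_span_pair_of_omega_eq_zero
    (hu.linearIndependent_stable 0) (hu.omega_u₁_u₂ 0) h14 h24)
  obtain ⟨m₁, h1⟩ := hu.exists_omega_centerStable (i := 0) (Or.inl rfl)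
  obtain ⟨m₂, h2⟩ := hu.exists_omega_centerStable (i := 1) (Or.inr rfl)
  obtain ⟨m₃, h3⟩ := hu.exists_omega_centerUnstable (i := 2) (Or.inl rfl)
  obtain ⟨m₄, h4⟩ := hu.exists_omega_centerUnstable (i := 3) (Or.inr rfl)
  -- One homogeneous linear equation in two unknowns: the Melnikov coefficient of `r u₃ + s u₄`
  -- shall be the same for both manifolds.
  obtain ⟨r, s, hrs, hne⟩ : ∃ r s : ℝ, r * m₃ + s * m₄ = r * m₂ + s * (p * m₁ + q * m₂) ∧
      ¬(r = 0 ∧ s = 0) := by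
    by_cases h : m₃ = m₂
    · exact ⟨1, 0, by rw [h]; ring, by simp⟩
    · exact ⟨p * m₁ + q * m₂ - m₄, m₃ - m₂, by ring, fun h' => h (sub_eq_zero.1 h'.2)⟩
  apply hne
  refine hind r s (omega_nondegenerate fun y => ?_)
  -- Test vectors without speed component suffice: in a decomposition along the two tangent spaces
  -- the speed components are opposite, and with equal coefficients their contributions cancel.
  have hy : ((y, 0) : Phase × ℝ) ∈
      P.tangentCenterUnstable w.c w.φ 0 ⊔ P.tangentCenterStable w.c w.φ 0 := by
    rw [w.transverse 0]; trivial
  obtain ⟨y₁, hy₁, y₂, hy₂, hsum⟩ := Submodule.mem_sup.1 hy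
  have e1 : y₁.1 + y₂.1 = y := congrArg Prod.fst hsum
  have e2 : y₁.2 + y₂.2 = 0 := congrArg Prod.snd hsum
  have k1 : omega (r • u 2 0 0 + s • u 3 0 0) y₁.1 = (r * m₃ + s * m₄) * y₁.2 := by
    simp only [map_add, map_smul, LinearMap.add_apply, LinearMap.smul_apply, smul_eq_mul,
      h3 _ hy₁, h4 _ hy₁]
    ring
  have k2 : omega (r • u 2 0 0 + s • u 3 0 0) y₂.1 = (r * m₂ + s * (p * m₁ + q * m₂)) * y₂.2 := by
    rw [← hpq, ← hu.u₂_zero_eq_u₃_zero]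
    simp only [map_add, map_smul, LinearMap.add_apply, LinearMap.smul_apply, smul_eq_mul,
      h1 _ hy₂, h2 _ hy₂]
    ring
  rw [← e1, map_add, k1, k2, hrs, ← mul_add, e2, mul_zero]

end IsAdaptedBasis
end TravelingWave

/-! ### Limits of determinants and signs across zeros -/

theorem detCols_smul (a b c d : Phase) (r s : ℝ) :
    detCols (r • a) (s • b) c d = r * s * detCols a b c d ∧
      detCols a b (r • c) (s • d) = r * s * detCols a b c d := by
  simp only [detCols, map_smul, LinearMap.smul_apply, smul_eq_mul]
  constructor <;> ring

theorem Filter.Tendsto.omega {X : Type*} {l : Filter X} {a b : X → Phase} {a' b' : Phase}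
    (ha : Tendsto a l (𝓝 a')) (hb : Tendsto b l (𝓝 b')) :
    Tendsto (fun x => _root_.omega (a x) (b x)) l (𝓝 (_root_.omega a' b')) := by
  have ha := tendsto_pi_nhds.1 ha
  have hb := tendsto_pi_nhds.1 hb
  simp only [omega_apply]
  exact (((ha 0).mul (hb 2)).sub ((ha 2).mul (hb 0))).sub
    (((ha 1).mul (hb 3)).sub ((ha 3).mul (hb 1)))

theorem Filter.Tendsto.detCols {X : Type*} {l : Filter X} {a b c d : X → Phase}
    {a' b' c' d' : Phase} (ha : Tendsto a l (𝓝 a')) (hb : Tendsto b l (𝓝 b'))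
    (hc : Tendsto c l (𝓝 c')) (hd : Tendsto d l (𝓝 d')) :
    Tendsto (fun x => _root_.detCols (a x) (b x) (c x) (d x)) l
      (𝓝 (_root_.detCols a' b' c' d')) :=
  (((ha.omega hb).mul (hc.omega hd)).sub ((ha.omega hc).mul (hb.omega hd))).add
    ((ha.omega hd).mul (hb.omega hc))

theorem Continuous.detCols {X : Type*} [TopologicalSpace X] {a b c d : X → Phase}
    (ha : Continuous a) (hb : Continuous b) (hc : Continuous c) (hd : Continuous d) :
    Continuous fun x => _root_.detCols (a x) (b x) (c x) (d x) :=
  continuous_iff_continuousAt.2 fun x =>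
    Filter.Tendsto.detCols (ha.tendsto x) (hb.tendsto x) (hc.tendsto x) (hd.tendsto x)

theorem eventually_pos_of_tendsto_div_pow {β : ℝ → ℝ} {z L : ℝ} {d : ℕ} (hL : L ≠ 0)
    (h : Tendsto (fun x => β x / (x - z) ^ d) (𝓝[≠] z) (𝓝 L)) :
    ∀ᶠ x in 𝓝[≠] z, 0 < L * (x - z) ^ d * β x := by
  have h1 : Tendsto (fun x => L * (β x / (x - z) ^ d)) (𝓝[≠] z) (𝓝 (L * L)) := h.const_mul L
  filter_upwards [h1.eventually_const_lt (mul_self_pos.2 hL), self_mem_nhdsWithin] with x hx hne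
  have h2 : (x - z) ^ d ≠ 0 := pow_ne_zero _ (sub_ne_zero.2 hne)
  have h3 := mul_pos hx (pow_pos (sq_pos_of_ne_zero (sub_ne_zero.2 hne)) d)
  rw [← pow_mul, mul_comm 2 d, pow_mul, sq] at h3
  field_simp at h3
  linarith

theorem mul_pos_of_ne_zero_on_Icc {β : ℝ → ℝ} (hβ : Continuous β) {x y : ℝ} (hxy : x ≤ y)
    (h : ∀ t ∈ Icc x y, β t ≠ 0) : 0 < β x * β y := by
  by_contra hneg
  push Not at hneg
  have hmem : (0 : ℝ) ∈ uIcc (β x) (β y) := by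
    rw [mem_uIcc]
    rcases mul_nonpos_iff.1 hneg with h | h
    · exact Or.inr ⟨h.2, h.1⟩
    · exact Or.inl h
  obtain ⟨t, ht, h0⟩ := intermediate_value_uIcc (hβ.continuousOn (s := uIcc x y)) hmem
  rw [uIcc_of_le hxy] at ht
  exact h t ht h0

/-- The sign of a continuous function is determined by its sign near `-∞` and by the parities of
the orders of its zeros. -/
theorem sign_of_orders {β : ℝ → ℝ} (hβ : Continuous β) {F : Finset ℝ} {d : ℝ → ℕ}
    (hF : ∀ z ∈ F, ∃ L : ℝ, ∀ᶠ x in 𝓝[≠] z, 0 < L * (x - z) ^ d z * β x)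
    (hbot : ∀ᶠ z in atBot, 0 < β z) {y : ℝ} (hy : ∀ z ≤ y, β z = 0 → z ∈ F ∧ z < y) :
    0 < (-1 : ℝ) ^ (∑ z ∈ F with z < y, d z) * β y := by
  induction hn : (F.filter (· < y)).card generalizing y with
  | zero =>
    rw [Finset.card_eq_zero] at hn
    rw [hn, Finset.sum_empty, pow_zero, one_mul]
    obtain ⟨x, hx, hxy⟩ := (hbot.and (eventually_le_atBot y)).exists
    have : 0 < β x * β y := mul_pos_of_ne_zero_on_Icc hβ hxy fun t ht h0 => by
      have : t ∈ F.filter (· < y) := Finset.mem_filter.2 (hy t ht.2 h0)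
      simp [hn] at this
    exact (mul_pos_iff_of_pos_left hx).1 this
  | succ n ih =>
    have hne : (F.filter (· < y)).Nonempty := Finset.card_pos.1 (by omega)
    -- The induction removes the last zero `p` below `y`: `x` is taken left of `p` beyond all
    -- earlier points of `F`, and `x'` right of `p` below `y`.
    set p := (F.filter (· < y)).max' hne with hp
    have hpm : p ∈ F.filter (· < y) := Finset.max'_mem _ _
    obtain ⟨hpF, hpy⟩ := Finset.mem_filter.1 hpm
    have hmax : ∀ t ∈ F, t < y → t ≤ p := fun t ht hty =>
      Finset.le_max' _ t (Finset.mem_filter.2 ⟨ht, hty⟩)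
    obtain ⟨L, hL⟩ := hF p hpF
    have hLleft : ∀ᶠ x in 𝓝[<] p, 0 < L * (x - p) ^ d p * β x ∧ ∀ t ∈ F, t < p → t < x := by
      refine (hL.filter_mono (nhdsWithin_mono _ fun x hx => ne_of_lt hx)).and ?_
      rw [eventually_all_finset]
      intro t _
      by_cases h : t < p
      · exact nhdsWithin_le_nhds ((lt_mem_nhds h).mono fun x hx _ => hx)
      · exact Eventually.of_forall fun x h' => absurd h' h
    have hLright : ∀ᶠ x in 𝓝[>] p, 0 < L * (x - p) ^ d p * β x ∧ x < y :=
      (hL.filter_mono (nhdsWithin_mono _ fun x hx => ne_of_gt hx)).and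
        (nhdsWithin_le_nhds (gt_mem_nhds hpy))
    obtain ⟨x, ⟨hx, hxF⟩, hxp⟩ := (hLleft.and self_mem_nhdsWithin).exists
    obtain ⟨x', ⟨hx', hx'y⟩, hpx'⟩ := (hLright.and self_mem_nhdsWithin).exists
    have hxp : x < p := hxp
    have hpx' : p < x' := hpx'
    have hfil : F.filter (· < y) = insert p (F.filter (· < x)) := by
      ext t
      simp only [Finset.mem_filter, Finset.mem_insert]
      constructor
      · rintro ⟨h1, h2⟩
        rcases (hmax t h1 h2).eq_or_lt with h | h
        · exact Or.inl h
        · exact Or.inr ⟨h1, hxF t h1 h⟩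
      · rintro (rfl | ⟨h1, h2⟩)
        · exact ⟨hpF, hpy⟩
        · exact ⟨h1, by linarith⟩
    have hpnot : p ∉ F.filter (· < x) := by simp [hxp.le]
    have hxne : β x ≠ 0 := fun h => by simp [h] at hx
    have hIH := ih (y := x) (fun z hz h0 => by
        refine ⟨(hy z (by linarith) h0).1, lt_of_le_of_ne hz ?_⟩
        rintro rfl
        exact hxne h0)
      (by rw [hfil, Finset.card_insert_of_notMem hpnot] at hn; omega)
    have hright : 0 < β x' * β y := mul_pos_of_ne_zero_on_Icc hβ hx'y.le fun t ht h0 => by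
      have h1 := hy t ht.2 h0
      have := hmax t h1.1 h1.2
      linarith [ht.1]
    -- Left of `p` the sign of `β` is that of `L (-1)^d`, right of `p` that of `L`; the unknown sign
    -- of `L` is eliminated by multiplying the two.
    have hleft : 0 < L * (-1) ^ d p * β x := by
      have e : L * (x - p) ^ d p * β x = L * (-1) ^ d p * β x * (p - x) ^ d p := by
        rw [show x - p = (-1) * (p - x) by ring, mul_pow]; ring
      rw [e] at hx
      exact (pos_iff_pos_of_mul_pos hx).2 (pow_pos (by linarith) _)
    have hr : 0 < L * β x' := by
      have e : L * (x' - p) ^ d p * β x' = L * β x' * (x' - p) ^ d p := by ring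
      rw [e] at hx'
      exact (pos_iff_pos_of_mul_pos hx').2 (pow_pos (by linarith) _)
    rw [hfil, Finset.sum_insert hpnot, pow_add]
    have hprod := mul_pos (mul_pos hIH hleft) (mul_pos hr hright)
    have e : (-1 : ℝ) ^ (∑ z ∈ F with z < x, d z) * β x * (L * (-1) ^ d p * β x) *
        (L * β x' * (β x' * β y)) =
        (L * β x * β x') ^ 2 * ((-1) ^ d p * (-1) ^ (∑ z ∈ F with z < x, d z) * β y) := by ring
    rw [e] at hprod
    by_contra hneg
    linarith [mul_nonpos_of_nonneg_of_nonpos (sq_nonneg (L * β x * β x')) (not_lt.1 hneg)]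

/-! ### The order of vanishing at a regular crossing -/

theorem finrank_span_pair {a b : Phase} (h : LinearIndependent ℝ ![a, b]) :
    Module.finrank ℝ (Submodule.span ℝ {a, b}) = 2 := by
  have := finrank_span_eq_card h
  rwa [Matrix.range_cons, Matrix.range_cons, Matrix.range_empty, union_empty,
    singleton_union, Fintype.card_fin] at this

/-- For a `2 × 2` matrix `m ≠ 0` with right kernel vector `x` and left kernel vector `y`: if the
derivative of the determinant in direction `n` vanishes, then `yᵀ n x = 0`. -/
theorem left_mul_right_eq_zero_of_det_deriv_eq_zero {m₁₁ m₁₂ m₂₁ m₂₂ n₁₁ n₁₂ n₂₁ n₂₂ x₁ x₂ y₁ y₂ : ℝ}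
    (hx₁ : m₁₁ * x₁ + m₁₂ * x₂ = 0) (hx₂ : m₂₁ * x₁ + m₂₂ * x₂ = 0)
    (hy₁ : y₁ * m₁₁ + y₂ * m₂₁ = 0) (hy₂ : y₁ * m₁₂ + y₂ * m₂₂ = 0)
    (hm : ¬(m₁₁ = 0 ∧ m₁₂ = 0 ∧ m₂₁ = 0 ∧ m₂₂ = 0))
    (hd : n₁₁ * m₂₂ + m₁₁ * n₂₂ - n₁₂ * m₂₁ - m₁₂ * n₂₁ = 0) :
    y₁ * n₁₁ * x₁ + y₁ * n₁₂ * x₂ + y₂ * n₂₁ * x₁ + y₂ * n₂₂ * x₂ = 0 := by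
  -- `hd` says `tr(adj(m) n) = 0`, and `x yᵀ` is a multiple of `adj(m)` when `m` has rank one. The
  -- identities below yield `mᵢⱼ Q = 0` for every entry without distinguishing ranks.
  set Q := y₁ * n₁₁ * x₁ + y₁ * n₁₂ * x₂ + y₂ * n₂₁ * x₁ + y₂ * n₂₂ * x₂ with hQ
  have h22 : m₂₂ * Q = 0 := by
    linear_combination x₁ * y₁ * hd + (y₁ * n₁₂ + y₂ * n₂₂) * hx₂ - n₂₂ * x₁ * hy₁ + n₂₁ * x₁ * hy₂
  have h11 : m₁₁ * Q = 0 := by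
    linear_combination x₂ * y₂ * hd + (y₁ * n₁₁ + y₂ * n₂₁) * hx₁ - n₁₁ * x₂ * hy₂ + n₁₂ * x₂ * hy₁
  have h12 : m₁₂ * Q = 0 := by
    linear_combination (-x₁ * y₂) * hd + (y₁ * n₁₂ + y₂ * n₂₂) * hx₁ + n₁₁ * x₁ * hy₂ - n₁₂ * x₁ * hy₁
  have h21 : m₂₁ * Q = 0 := by
    linear_combination (-x₂ * y₁) * hd + (y₁ * n₁₁ + y₂ * n₂₁) * hx₂ + n₂₂ * x₂ * hy₁ - n₂₁ * x₂ * hy₂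
  by_contra h
  exact hm ⟨(mul_eq_zero.1 h11).resolve_right h, (mul_eq_zero.1 h12).resolve_right h,
    (mul_eq_zero.1 h21).resolve_right h, (mul_eq_zero.1 h22).resolve_right h⟩

theorem omega_eq_zero_of_mem_span_pair {a b x y : Phase} (h : omega a b = 0)
    (hx : x ∈ Submodule.span ℝ {a, b}) (hy : y ∈ Submodule.span ℝ {a, b}) : omega x y = 0 := by
  obtain ⟨p, q, rfl⟩ := Submodule.mem_span_pair.1 hx
  obtain ⟨r, s, rfl⟩ := Submodule.mem_span_pair.1 hy
  have h' : omega b a = 0 := by rw [omega_swap, h, neg_zero]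
  simp [omega_self, h, h']

/-- At a regular crossing of a path of Lagrangian planes with a fixed Lagrangian plane the
determinant vanishes exactly to the order of the dimension of the intersection. -/
theorem exists_tendsto_detCols_div_pow {v₁ v₂ : Phase} {e₁ e₂ : ℝ → Phase} {z : ℝ}
    (T : Phase →ₗ[ℝ] Phase) (hv : LinearIndependent ℝ ![v₁, v₂]) (hvω : omega v₁ v₂ = 0)
    (he : LinearIndependent ℝ ![e₁ z, e₂ z]) (heω : omega (e₁ z) (e₂ z) = 0)
    (h₁ : HasDerivAt e₁ (T (e₁ z)) z) (h₂ : HasDerivAt e₂ (T (e₂ z)) z)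
    {W : Submodule ℝ Phase}
    (hW : W = Submodule.span ℝ {e₁ z, e₂ z} ⊓ Submodule.span ℝ {v₁, v₂}) (hne : W ≠ ⊥)
    (hnd : ∀ x ∈ W, x ≠ 0 → ∃ y ∈ W, omega y (T x) ≠ 0) :
    ∃ L ≠ 0, Tendsto (fun x => detCols v₁ v₂ (e₁ x) (e₂ x) / (x - z) ^ Module.finrank ℝ W)
      (𝓝[≠] z) (𝓝 L) := by
  set E := Submodule.span ℝ {e₁ z, e₂ z}
  set V := Submodule.span ℝ {v₁, v₂}
  have hv₁ : v₁ ∈ V := Submodule.subset_span (by simp)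
  have hv₂ : v₂ ∈ V := Submodule.subset_span (by simp)
  have he₁ : e₁ z ∈ E := Submodule.subset_span (by simp)
  have he₂ : e₂ z ∈ E := Submodule.subset_span (by simp)
  have hV2 : Module.finrank ℝ V = 2 := finrank_span_pair hv
  have hE2 : Module.finrank ℝ E = 2 := finrank_span_pair he
  have hWV : W ≤ V := hW ▸ inf_le_right
  have hWE : W ≤ E := hW ▸ inf_le_left
  -- As `v₁, v₂` are isotropic, the determinant is minus that of the `2 × 2` matrix `ω(vᵢ, eⱼ(x))`.
  -- The cases below are whether this matrix vanishes at `z` (the planes coincide) or not (they meet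
  -- in a line).
  have hdet : ∀ x, detCols v₁ v₂ (e₁ x) (e₂ x) =
      -(omega v₁ (e₁ x) * omega v₂ (e₂ x)) + omega v₁ (e₂ x) * omega v₂ (e₁ x) := fun x => by
    rw [detCols, hvω]; ring
  have hd : ∀ v : Phase, ∀ e : ℝ → Phase, HasDerivAt e (T (e z)) z →
      HasDerivAt (fun x => omega v (e x)) (omega v (T (e z))) z := fun v e h => by
    simpa using (hasDerivAt_const z v).omega h
  by_cases hM : omega v₁ (e₁ z) = 0 ∧ omega v₁ (e₂ z) = 0 ∧ omega v₂ (e₁ z) = 0 ∧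
      omega v₂ (e₂ z) = 0
  · obtain ⟨m11, m12, m21, m22⟩ := hM
    have hEV : E ≤ V := by
      refine Submodule.span_le.2 ?_
      rintro _ (rfl | rfl)
      exacts [mem_span_pair_of_omega_eq_zero hv hvω m11 m21,
        mem_span_pair_of_omega_eq_zero hv hvω m12 m22]
    have hWE' : W = E := by rw [hW]; exact inf_eq_left.2 hEV
    rw [hWE', hE2]
    refine ⟨-(omega v₁ (T (e₁ z)) * omega v₂ (T (e₂ z))) +
      omega v₁ (T (e₂ z)) * omega v₂ (T (e₁ z)), ?_, ?_⟩
    · intro h0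
      -- If the leading coefficient vanished, a kernel vector `c` of the derivative matrix would
      -- give `e ∈ W` with `ω(y, T e) = 0` for all `y` in the span of `v₁, v₂`, contrary to
      -- nondegeneracy.
      obtain ⟨c, hc, hcM⟩ := (Matrix.exists_mulVec_eq_zero_iff (M :=
        !![omega v₁ (T (e₁ z)), omega v₁ (T (e₂ z)); omega v₂ (T (e₁ z)), omega v₂ (T (e₂ z))])).2
        (by rw [Matrix.det_fin_two_of]; linarith)
      have c1 := congrFun hcM 0
      have c2 := congrFun hcM 1
      simp [Matrix.mulVec, dotProduct, Fin.sum_univ_two] at c1 c2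
      set e := c 0 • e₁ z + c 1 • e₂ z
      have heW : e ∈ W := hWE' ▸ Submodule.mem_span_pair.2 ⟨_, _, rfl⟩
      have hene : e ≠ 0 := fun h => hc <| by
        have := LinearIndependent.pair_iff.1 he _ _ h
        ext i; fin_cases i
        exacts [this.1, this.2]
      obtain ⟨y, hy, hyT⟩ := hnd e heW hene
      obtain ⟨p, q, rfl⟩ := Submodule.mem_span_pair.1 (hWV hy)
      apply hyT
      simp only [e, map_add, map_smul, LinearMap.add_apply, LinearMap.smul_apply, smul_eq_mul]
      linear_combination p * c1 + q * c2
    · have hs : ∀ v : Phase, ∀ e : ℝ → Phase, HasDerivAt e (T (e z)) z → omega v (e z) = 0 →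
          Tendsto (fun x => omega v (e x) / (x - z)) (𝓝[≠] z) (𝓝 (omega v (T (e z)))) :=
        fun v e h h0 => by
          refine (hasDerivAt_iff_tendsto_slope.1 (hd v e h)).congr fun x => ?_
          rw [slope_def_field, h0, sub_zero]
      refine ((((hs v₁ e₁ h₁ m11).mul (hs v₂ e₂ h₂ m22)).neg).add
        ((hs v₁ e₂ h₂ m12).mul (hs v₂ e₁ h₁ m21))).congr' ?_
      filter_upwards [self_mem_nhdsWithin] with x hx
      have hx : x - z ≠ 0 := sub_ne_zero.2 hx
      rw [hdet]
      field_simp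
  · have hW1 : Module.finrank ℝ W = 1 := by
      have h1 : Module.finrank ℝ W ≤ 2 := hV2 ▸ Submodule.finrank_mono hWV
      have h2 : Module.finrank ℝ W ≠ 0 := fun h => hne (Submodule.finrank_eq_zero.1 h)
      have h3 : Module.finrank ℝ W ≠ 2 := fun h => hM <| by
        have a1 : W = V := Submodule.eq_of_le_of_finrank_eq hWV (h.trans hV2.symm)
        have a2 : W = E := Submodule.eq_of_le_of_finrank_eq hWE (h.trans hE2.symm)
        have a3 : E = V := a2.symm.trans a1
        have k : ∀ v ∈ V, ∀ e ∈ E, omega v e = 0 := fun v hv e he =>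
          omega_eq_zero_of_mem_span_pair hvω hv (a3.le he)
        exact ⟨k _ hv₁ _ he₁, k _ hv₁ _ he₂, k _ hv₂ _ he₁, k _ hv₂ _ he₂⟩
      omega
    obtain ⟨ξ, hξW, hξ⟩ := Submodule.exists_mem_ne_zero_of_ne_bot hne
    obtain ⟨x₁, x₂, hx⟩ := Submodule.mem_span_pair.1 (hWE hξW)
    obtain ⟨y₁, y₂, hy⟩ := Submodule.mem_span_pair.1 (hWV hξW)
    have hder : HasDerivAt (fun x => detCols v₁ v₂ (e₁ x) (e₂ x))
        (-(omega v₁ (T (e₁ z)) * omega v₂ (e₂ z) + omega v₁ (e₁ z) * omega v₂ (T (e₂ z))) +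
          (omega v₁ (T (e₂ z)) * omega v₂ (e₁ z) + omega v₁ (e₂ z) * omega v₂ (T (e₁ z)))) z := by
      simp only [hdet]
      exact (((hd v₁ e₁ h₁).mul (hd v₂ e₂ h₂)).neg).add ((hd v₁ e₂ h₂).mul (hd v₂ e₁ h₁))
    have rel : ∀ v ∈ V, omega v (e₁ z) * x₁ + omega v (e₂ z) * x₂ = 0 := fun v hvV => by
      have := omega_eq_zero_of_mem_span_pair hvω hvV (hWV hξW)
      rw [← hx] at this
      simp only [map_add, map_smul, smul_eq_mul] at this
      linarith
    have rel' : ∀ e ∈ E, y₁ * omega v₁ e + y₂ * omega v₂ e = 0 := fun e heE => by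
      have := omega_eq_zero_of_mem_span_pair heω (hWE hξW) heE
      rw [← hy] at this
      simpa only [map_add, map_smul, smul_eq_mul, LinearMap.add_apply, LinearMap.smul_apply]
        using this
    have h0 : detCols v₁ v₂ (e₁ z) (e₂ z) = 0 := by
      by_contra h
      exact hne (hW.trans ((inf_comm _ _).trans ((span_inf_span_eq_bot_iff hv he).2 h)))
    refine ⟨_, ?_, (hasDerivAt_iff_tendsto_slope.1 hder).congr fun x => ?_⟩
    rotate_left
    · rw [slope_def_field, h0, sub_zero, hW1, pow_one]
    · intro hL
      -- The coordinates of `ξ` in the basis `e₁, e₂` form a right kernel vector, those in the basis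
      -- `v₁, v₂` a left one. A vanishing derivative of the determinant therefore means `ω(ξ, T ξ) =
      -- 0`, on a line that `ξ` spans.
      have key := left_mul_right_eq_zero_of_det_deriv_eq_zero (rel v₁ hv₁) (rel v₂ hv₂)
        (rel' _ he₁) (rel' _ he₂) hM (n₁₁ := omega v₁ (T (e₁ z))) (n₁₂ := omega v₁ (T (e₂ z)))
        (n₂₁ := omega v₂ (T (e₁ z))) (n₂₂ := omega v₂ (T (e₂ z))) (by linarith)
      obtain ⟨y, hyW, hyT⟩ := hnd ξ hξW hξ
      obtain ⟨r, hr⟩ := (finrank_eq_one_iff_of_nonzero' (⟨ξ, hξW⟩ : W)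
        (by simpa using hξ)).1 hW1 ⟨y, hyW⟩
      have hr' : r • ξ = y := congrArg Subtype.val hr
      apply hyT
      have : omega ξ (T ξ) = 0 := by
        have e : T ξ = x₁ • T (e₁ z) + x₂ • T (e₂ z) := by rw [← hx, map_add, map_smul, map_smul]
        rw [e, ← hy]
        simp only [map_add, map_smul, LinearMap.add_apply, LinearMap.smul_apply, smul_eq_mul]
        linarith
      rw [← hr', map_smul, LinearMap.smul_apply, this, smul_zero]

theorem sigPos_add_sigNeg_eq_finrank {M : Type*} [AddCommGroup M] [Module ℝ M]
    [FiniteDimensional ℝ M] {Q : QuadraticForm ℝ M}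
    (hQ : LinearMap.BilinForm.Nondegenerate Q.polarBilin) :
    sigPos Q + sigNeg Q = Module.finrank ℝ M := by
  have h := QuadraticForm.sigPos_add_sigNeg_add_radical (Q := Q)
  have h2 : Q.radical = ⊥ := by
    rw [eq_bot_iff]
    intro x hx
    exact hQ.1 x fun y => by
      rw [show Q.polarBilin x = 0 from hx.2]; rfl
  rw [h2, finrank_bot, add_zero] at h
  exact h

theorem neg_one_zpow_finsum_sub {F : Finset ℝ} (p q : ℝ → ℕ) (s : ℕ) :
    (-1 : ℝ) ^ ((∑ z ∈ F, ((p z : ℤ) - (q z : ℤ))) + (s : ℤ)) =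
      (-1) ^ (∑ z ∈ F, (p z + q z)) * (-1) ^ s := by
  have e : (∑ z ∈ F, ((p z : ℤ) - (q z : ℤ))) + (s : ℤ) =
      ((∑ z ∈ F, (p z + q z) + s : ℕ) : ℤ) - ((2 * ∑ z ∈ F, q z : ℕ) : ℤ) := by
    push_cast
    rw [Finset.sum_add_distrib, Finset.sum_sub_distrib]
    ring
  rw [e, zpow_sub₀ (by norm_num), zpow_natCast, zpow_natCast, pow_mul, pow_add]
  simp

/-! ### The crossings of the wave: orders, sign near `-∞`, finiteness -/

namespace TravelingWave

variable {P : ActivatorInhibitorSystem} {w : TravelingWave P}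

theorem crossingForm_apply (u : Fin 4 → ℝ → ℝ → Phase) (τ z : ℝ)
    (ξ : ↥(unstableBundle u 0 z ⊓ stableBundle u 0 τ)) :
    w.crossingForm u τ z ξ = omega (ξ : Phase) (Matrix.mulVec (w.A 0 z) ξ) := rfl

namespace IsAdaptedBasis

variable {δ : ℝ} {u : Fin 4 → ℝ → ℝ → Phase} {η : Fin 4 → ℝ → Phase}
  (hu : w.IsAdaptedBasis δ u η)

include hu

theorem isCrossing_iff (τ z : ℝ) : IsCrossing u τ z ↔
    detCols (u 0 0 τ) (u 1 0 τ) (u 2 0 z) (u 3 0 z) = 0 := by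
  rw [IsCrossing, unstableBundle, stableBundle, inf_comm, ne_eq,
    span_inf_span_eq_bot_iff (hu.linearIndependent_stable τ) (hu.linearIndependent_unstable z),
    not_not]

/-- The bilinear form `ω(·, A ·)` is symmetric on the intersection, since by `omega_coeffMatrix` its
antisymmetric part is a multiple of `ω`, which vanishes on `E^s(0,τ)`. The polar form is therefore
twice this form. -/
theorem exists_omega_ne_zero_of_isRegular {τ z : ℝ} (h : w.IsRegular u τ z) {x : Phase}
    (hx : x ∈ unstableBundle u 0 z ⊓ stableBundle u 0 τ) (hx0 : x ≠ 0) :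
    ∃ y ∈ unstableBundle u 0 z ⊓ stableBundle u 0 τ,
      omega y (Matrix.toLin' (w.A 0 z) x) ≠ 0 := by
  by_contra H
  push Not at H
  have := h.1 ⟨x, hx⟩ fun y => ?_
  · exact hx0 (congrArg Subtype.val this)
  have h1 := H y y.2
  have h2 := P.omega_coeffMatrix w.c 0 0 (w.φ z) y x
  have h3 : omega (y : Phase) x = 0 := omega_eq_zero_of_mem_span_pair (hu.omega_u₁_u₂ τ) y.2.2 hx.2
  rw [Matrix.toLin'_apply] at h1
  simp only [A] at h1
  rw [QuadraticMap.polarBilin_apply_apply, QuadraticMap.polar, crossingForm_apply,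
    crossingForm_apply, crossingForm_apply]
  simp only [Submodule.coe_add, Matrix.mulVec_add, map_add, LinearMap.add_apply, A, h1]
  have h4 := omega_swap x (Matrix.mulVec (P.coeffMatrix w.c 0 (w.φ z)) y)
  simp only [h1, h3] at h2
  linarith

theorem exists_tendsto_at_crossing {τ z : ℝ} (hc : IsCrossing u τ z) (h : w.IsRegular u τ z) :
    ∃ L ≠ 0, Tendsto (fun x => detCols (u 0 0 τ) (u 1 0 τ) (u 2 0 x) (u 3 0 x) /
      (x - z) ^ (sigPos (w.crossingForm u τ z) + sigNeg (w.crossingForm u τ z)))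
      (𝓝[≠] z) (𝓝 L) := by
  rw [sigPos_add_sigNeg_eq_finrank h]
  exact exists_tendsto_detCols_div_pow (Matrix.toLin' (w.A 0 z)) (hu.linearIndependent_stable τ)
    (hu.omega_u₁_u₂ τ) (hu.linearIndependent_unstable z) (hu.omega_u₃_u₄ z)
    (hu.solves_zero 2 z) (hu.solves_zero 3 z) rfl hc
    fun x hx hx0 => hu.exists_omega_ne_zero_of_isRegular h hx hx0

theorem detCols_η_pos : 0 < detCols (η 0 0) (η 1 0) (η 2 0) (η 3 0) := by
  have := hu.orientation
  rwa [det_of_columns (fun j => η j 0)] at this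

theorem linearIndependent_η : LinearIndependent ℝ ![η 2 0, η 3 0] := by
  rw [LinearIndependent.pair_iff]
  intro r s hrs
  by_contra h
  refine hu.detCols_η_pos.ne' ((detCols_eq_zero_iff _ _ _ _).2 ⟨![0, 0, r, s], fun h0 => h ?_, ?_⟩)
  · exact ⟨congrFun h0 2, congrFun h0 3⟩
  · simpa using hrs

/-- The condition on `τ` keeps the determinant nonzero on `[τ, ∞)`; far out, after rescaling by
positive factors, it approaches the positive determinant of the `η_i`. -/
theorem detCols_stable_η_pos {τ : ℝ}
    (hτ : ∀ τ' ≥ τ, w.unstableSubspace ⊓ stableBundle u 0 τ' = ⊥) :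
    0 < detCols (u 0 0 τ) (u 1 0 τ) (η 2 0) (η 3 0) := by
  have hcont : Continuous fun t => detCols (u 0 0 t) (u 1 0 t) (η 2 0) (η 3 0) :=
    (hu.continuous_zero 0).detCols (hu.continuous_zero 1) continuous_const continuous_const
  have hne : ∀ t ≥ τ, detCols (u 0 0 t) (u 1 0 t) (η 2 0) (η 3 0) ≠ 0 := fun t ht => by
    rw [← span_inf_span_eq_bot_iff (hu.linearIndependent_stable t) hu.linearIndependent_η,
      eq_bot_iff, ← hτ t ht, inf_comm]
    refine inf_le_inf_right _ (Submodule.span_le.2 ?_)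
    rintro _ (rfl | rfl)
    · exact Submodule.mem_sup_left (hu.eigenvector 2 0 hu.zero_mem).1
    · exact Submodule.mem_sup_right (hu.eigenvector 3 0 hu.zero_mem).1
  have hlim := (hu.limit_zero_atTop (Or.inl rfl)).detCols (hu.limit_zero_atTop (Or.inr rfl))
    (tendsto_const_nhds (x := η 2 0)) (tendsto_const_nhds (x := η 3 0))
  obtain ⟨t, ht, htτ⟩ := ((hlim.eventually_const_lt hu.detCols_η_pos).and
    (eventually_ge_atTop τ)).exists
  simp only [(detCols_smul _ _ _ _ _ _).1] at ht
  have ht' := (pos_iff_pos_of_mul_pos ht).1 (by positivity)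
  have := mul_pos_of_ne_zero_on_Icc hcont htτ fun s hs => hne s hs.1
  exact (pos_iff_pos_of_mul_pos this).2 ht'

theorem eventually_detCols_pos {τ : ℝ}
    (hτ : ∀ τ' ≥ τ, w.unstableSubspace ⊓ stableBundle u 0 τ' = ⊥) :
    ∀ᶠ z in atBot, 0 < detCols (u 0 0 τ) (u 1 0 τ) (u 2 0 z) (u 3 0 z) := by
  have hlim := (tendsto_const_nhds (x := u 0 0 τ)).detCols (tendsto_const_nhds (x := u 1 0 τ))
    (hu.limit_zero_atBot (Or.inl rfl)) (hu.limit_zero_atBot (Or.inr rfl))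
  filter_upwards [hlim.eventually_const_lt (hu.detCols_stable_η_pos hτ)] with z hz
  simp only [(detCols_smul _ _ _ _ _ _).2] at hz
  exact (pos_iff_pos_of_mul_pos hz).1 (by positivity)

theorem continuous_detCols_unstable (τ : ℝ) :
    Continuous fun z => detCols (u 0 0 τ) (u 1 0 τ) (u 2 0 z) (u 3 0 z) :=
  Continuous.detCols continuous_const continuous_const (hu.continuous_zero 2)
    (hu.continuous_zero 3)

theorem finite_crossings {τ : ℝ}
    (hτ : ∀ τ' ≥ τ, w.unstableSubspace ⊓ stableBundle u 0 τ' = ⊥)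
    (hreg : ∀ z ≤ τ, IsCrossing u τ z → w.IsRegular u τ z) :
    {z | z ≤ τ ∧ IsCrossing u τ z}.Finite := by
  by_contra hinf
  obtain ⟨N, hN⟩ := (hu.eventually_detCols_pos hτ).exists_forall_of_atBot
  have hsub : {z | z ≤ τ ∧ IsCrossing u τ z} ⊆ Icc N τ := fun z hz => by
    refine ⟨le_of_not_ge fun h => ?_, hz.1⟩
    exact (hN z h).ne' ((hu.isCrossing_iff τ z).1 hz.2)
  -- Crossings are bounded below because `β > 0` near `-∞`. An accumulation point would itself be a
  -- regular crossing by closedness, but `β` has no other zero near such a point.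
  obtain ⟨z, hz, hacc⟩ := Set.Infinite.exists_accPt_of_subset_isCompact hinf isCompact_Icc hsub
  have hclosed : IsClosed {z | z ≤ τ ∧ IsCrossing u τ z} := by
    have : {z | z ≤ τ ∧ IsCrossing u τ z} =
        Iic τ ∩ (fun z => detCols (u 0 0 τ) (u 1 0 τ) (u 2 0 z) (u 3 0 z)) ⁻¹' {0} := by
      ext z; simp [hu.isCrossing_iff]
    rw [this]
    exact isClosed_Iic.inter (isClosed_singleton.preimage (hu.continuous_detCols_unstable τ))
  have hzmem : z ≤ τ ∧ IsCrossing u τ z := by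
    have := hacc.clusterPt.mem_closure
    rwa [hclosed.closure_eq] at this
  obtain ⟨L, hL, h⟩ := hu.exists_tendsto_at_crossing hzmem.2 (hreg z hzmem.1 hzmem.2)
  obtain ⟨x, hx, hpos⟩ := ((accPt_iff_frequently_nhdsNE.1 hacc).and_eventually
    (eventually_pos_of_tendsto_div_pow hL h)).exists
  rw [(hu.isCrossing_iff τ x).1 hx.2, mul_zero] at hpos
  exact lt_irrefl _ hpos

end IsAdaptedBasis
end TravelingWave

/-! ### The endpoint crossing and the parity of the Maslov index -/

theorem sigPos_eq_one_of_pos {M : Type*} [AddCommGroup M] [Module ℝ M] [FiniteDimensional ℝ M]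
    {Q : QuadraticForm ℝ M} (h : Module.finrank ℝ M = 1) {ξ : M} (hξ : 0 < Q ξ) :
    sigPos Q = 1 := by
  refine le_antisymm (h ▸ sigPos_le_finrank Q) ?_
  have hξ0 : ξ ≠ 0 := by rintro rfl; simp at hξ
  have hpos : (Q.restrict ⊤).PosDef := by
    intro y hy
    obtain ⟨r, hry⟩ := (finrank_eq_one_iff_of_nonzero' ξ hξ0).1 h y
    have hr : r ≠ 0 := by
      rintro rfl
      exact hy (Subtype.ext (by rw [← hry, zero_smul]; rfl))
    rw [QuadraticMap.restrict_apply, ← hry, QuadraticMap.map_smul, smul_eq_mul]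
    exact mul_pos (mul_self_pos.2 hr) hξ
  have := le_sigPos_of_posDef Q hpos
  rwa [finrank_top, h] at this

theorem sigPos_eq_zero_of_neg {M : Type*} [AddCommGroup M] [Module ℝ M] [FiniteDimensional ℝ M]
    {Q : QuadraticForm ℝ M} (h : Module.finrank ℝ M = 1) {ξ : M} (hξ : Q ξ < 0) :
    sigPos Q = 0 := by
  have hξ0 : ξ ≠ 0 := by rintro rfl; simp at hξ
  have := QuadraticForm.sigPos_add_finrank_le_of_nonpos (Q := Q) (V := ⊤) fun y _ => by
    obtain ⟨r, rfl⟩ := (finrank_eq_one_iff_of_nonzero' ξ hξ0).1 h y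
    rw [QuadraticMap.map_smul, smul_eq_mul]
    exact mul_nonpos_of_nonneg_of_nonpos (mul_self_nonneg r) hξ.le
  rw [finrank_top, h] at this
  omega

theorem neg_one_pow_mul_neg_sign {n : ℕ} {a b : ℝ} (h : (-1 : ℝ) ^ n * (a * b) < 0) :
    (-1 : ℝ) ^ n * -Real.sign b = Real.sign a := by
  rcases neg_one_pow_eq_or ℝ n with hn | hn <;> rw [hn] at h ⊢
  · rcases mul_neg_iff.1 (by linarith : a * b < 0) with ⟨h1, h2⟩ | ⟨h1, h2⟩ <;>
      simp [Real.sign_of_pos, Real.sign_of_neg, h1, h2]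
  · rcases mul_pos_iff.1 (by linarith : 0 < a * b) with ⟨h1, h2⟩ | ⟨h1, h2⟩ <;>
      simp [Real.sign_of_pos, Real.sign_of_neg, h1, h2]

namespace TravelingWave.IsAdaptedBasis

variable {P : ActivatorInhibitorSystem} {w : TravelingWave P}
  {δ : ℝ} {u : Fin 4 → ℝ → ℝ → Phase} {η : Fin 4 → ℝ → Phase}
  (hu : w.IsAdaptedBasis δ u η)

include hu

theorem sign_lazutkinTreschev (z z' : ℝ) :
    Real.sign (w.lazutkinTreschev u z) = Real.sign (omega (u 0 0 z') (u 3 0 z')) := by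
  rw [lazutkinTreschev, w.bigOmega_eq (hu.solves_zero 0) (hu.solves_zero 3) z z', bigOmega]
  have h := Real.exp_pos (w.c * z')
  rcases lt_trichotomy (omega (u 0 0 z') (u 3 0 z')) 0 with h1 | h1 | h1
  · rw [Real.sign_of_neg h1, Real.sign_of_neg (mul_neg_of_pos_of_neg h h1)]
  · rw [h1, mul_zero]
  · rw [Real.sign_of_pos h1, Real.sign_of_pos (mul_pos h h1)]

theorem omega_u₁_u₄_ne_zero' (z : ℝ) : omega (u 0 0 z) (u 3 0 z) ≠ 0 := fun h => by
  have := w.bigOmega_eq (hu.solves_zero 0) (hu.solves_zero 3) z 0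
  rw [bigOmega_zero, bigOmega, h, mul_zero] at this
  exact hu.omega_u₁_u₄_ne_zero this.symm

theorem u₂_mem (τ : ℝ) : u 1 0 τ ∈ unstableBundle u 0 τ ⊓ stableBundle u 0 τ :=
  ⟨hu.u₂_zero_eq_u₃_zero τ ▸ Submodule.subset_span (by simp), Submodule.subset_span (by simp)⟩

theorem u₂_ne_zero (τ : ℝ) : u 1 0 τ ≠ 0 := fun h => by
  have := LinearIndependent.pair_iff.1 (hu.linearIndependent_stable τ) 0 1 (by simp [h])
  exact one_ne_zero this.2

theorem isCrossing_self (τ : ℝ) : IsCrossing u τ τ :=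
  Submodule.ne_bot_iff _ |>.2 ⟨_, hu.u₂_mem τ, hu.u₂_ne_zero τ⟩

/-- The intersection at `τ` contains `φ'(τ)`. If it were two-dimensional, `E^u` and `E^s` would
coincide and `ω(u₁,u₄)` would vanish. -/
theorem finrank_inf_self (τ : ℝ) :
    Module.finrank ℝ ↥(unstableBundle u 0 τ ⊓ stableBundle u 0 τ) = 1 := by
  have hV2 : Module.finrank ℝ (stableBundle u 0 τ) = 2 :=
    finrank_span_pair (hu.linearIndependent_stable τ)
  have hE2 : Module.finrank ℝ (unstableBundle u 0 τ) = 2 :=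
    finrank_span_pair (hu.linearIndependent_unstable τ)
  have h1 : Module.finrank ℝ ↥(unstableBundle u 0 τ ⊓ stableBundle u 0 τ) ≤ 2 :=
    hV2 ▸ Submodule.finrank_mono inf_le_right
  have h2 : Module.finrank ℝ ↥(unstableBundle u 0 τ ⊓ stableBundle u 0 τ) ≠ 0 :=
    fun h => hu.isCrossing_self τ (Submodule.finrank_eq_zero.1 h)
  have h3 : Module.finrank ℝ ↥(unstableBundle u 0 τ ⊓ stableBundle u 0 τ) ≠ 2 := fun h => by
    have a1 := Submodule.eq_of_le_of_finrank_eq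
      (inf_le_right : unstableBundle u 0 τ ⊓ stableBundle u 0 τ ≤ _) (h.trans hV2.symm)
    have a2 := Submodule.eq_of_le_of_finrank_eq
      (inf_le_left : unstableBundle u 0 τ ⊓ stableBundle u 0 τ ≤ _) (h.trans hE2.symm)
    refine hu.omega_u₁_u₄_ne_zero' τ (omega_eq_zero_of_mem_span_pair (hu.omega_u₁_u₂ τ)
      (Submodule.subset_span (by simp)) ?_)
    exact (a2.symm.trans a1).le (Submodule.subset_span (by simp))
  omega

theorem crossingForm_u₂_ne_zero {τ : ℝ} (h : w.IsRegular u τ τ) :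
    w.crossingForm u τ τ ⟨u 1 0 τ, hu.u₂_mem τ⟩ ≠ 0 := by
  intro h0
  obtain ⟨y, hy, hyT⟩ := hu.exists_omega_ne_zero_of_isRegular h (hu.u₂_mem τ) (hu.u₂_ne_zero τ)
  obtain ⟨r, hr⟩ := (finrank_eq_one_iff_of_nonzero' (⟨_, hu.u₂_mem τ⟩ :
    ↥(unstableBundle u 0 τ ⊓ stableBundle u 0 τ)) (by simpa using hu.u₂_ne_zero τ)).1
    (hu.finrank_inf_self τ) ⟨y, hy⟩
  have hr' : r • u 1 0 τ = y := congrArg Subtype.val hr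
  rw [crossingForm_apply] at h0
  apply hyT
  rw [← hr', map_smul, LinearMap.smul_apply, Matrix.toLin'_apply, h0, smul_zero]

/-- On the line spanned by `φ'(τ)` the index `n₊` is `1` or `0` according to the sign of the form at
`φ'(τ)`. -/
theorem neg_one_pow_sigPos_self {τ : ℝ} (h : w.IsRegular u τ τ) :
    (-1 : ℝ) ^ sigPos (w.crossingForm u τ τ) =
      -Real.sign (omega (u 1 0 τ) (Matrix.mulVec (w.A 0 τ) (u 1 0 τ))) := by
  have h1 := hu.crossingForm_u₂_ne_zero h
  have h2 := crossingForm_apply (w := w) u τ τ ⟨u 1 0 τ, hu.u₂_mem τ⟩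
  rw [← h2]
  rcases lt_or_gt_of_ne h1 with h1 | h1
  · rw [sigPos_eq_zero_of_neg (hu.finrank_inf_self τ) h1, Real.sign_of_neg h1]; norm_num
  · rw [sigPos_eq_one_of_pos (hu.finrank_inf_self τ) h1, Real.sign_of_pos h1]; norm_num

/-- At `z = τ` both factors of `ω₁₃ ω₂₄` vanish, so this product does not contribute; in `ω₁₄ ω₂₃`
only the second factor vanishes, and its derivative is the crossing form at `φ'(τ)`. -/
theorem hasDerivAt_detCols_self (τ : ℝ) :
    HasDerivAt (fun z => detCols (u 0 0 τ) (u 1 0 τ) (u 2 0 z) (u 3 0 z))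
      (omega (u 0 0 τ) (u 3 0 τ) *
        omega (u 1 0 τ) (Matrix.mulVec (w.A 0 τ) (u 1 0 τ))) τ := by
  have hd : ∀ (v : Phase) (i : Fin 4), HasDerivAt (fun z => omega v (u i 0 z))
      (omega v (Matrix.mulVec (w.A 0 τ) (u i 0 τ))) τ := fun v i => by
    simpa using (hasDerivAt_const τ v).omega (hu.solves_zero i τ)
  have h12 := hu.omega_u₁_u₂ τ
  have h34 := hu.omega_u₃_u₄ τ
  simp only [detCols, h12, zero_mul, zero_sub]
  refine ((((hd (u 0 0 τ) 2).mul (hd (u 1 0 τ) 3)).neg).add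
    ((hd (u 0 0 τ) 3).mul (hd (u 1 0 τ) 2))).congr_deriv ?_
  rw [← hu.u₂_zero_eq_u₃_zero τ] at h34 ⊢
  rw [h12, h34, omega_self]
  ring

theorem neg_one_zpow_maslov {τ : ℝ}
    (hτ : ∀ τ' ≥ τ, w.unstableSubspace ⊓ stableBundle u 0 τ' = ⊥)
    (hreg : ∀ z ≤ τ, IsCrossing u τ z → w.IsRegular u τ z) (z : ℝ) :
    (-1 : ℝ) ^ w.maslov u τ = Real.sign (w.lazutkinTreschev u z) := by
  have hfin := (hu.finite_crossings hτ hreg).subset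
    (show {z | z < τ ∧ IsCrossing u τ z} ⊆ _ from fun z hz => ⟨hz.1.le, hz.2⟩)
  set F := hfin.toFinset with hF
  set β := fun z => detCols (u 0 0 τ) (u 1 0 τ) (u 2 0 z) (u 3 0 z) with hβ
  have hmem : ∀ z, z ∈ F ↔ z < τ ∧ IsCrossing u τ z := fun z => by simp [hF]
  have hregτ := hreg τ le_rfl (hu.isCrossing_self τ)
  set G := omega (u 0 0 τ) (u 3 0 τ) with hG
  set g := omega (u 1 0 τ) (Matrix.mulVec (w.A 0 τ) (u 1 0 τ)) with hg
  have hG0 : G ≠ 0 := hu.omega_u₁_u₄_ne_zero' τ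
  have hg0 : g ≠ 0 := hu.crossingForm_u₂_ne_zero hregτ
  have hβτ : β τ = 0 := (hu.isCrossing_iff τ τ).1 (hu.isCrossing_self τ)
  -- A point `y` just left of `τ`, beyond all earlier crossings, at which the sign of `β` is known
  -- from `β'(τ) = G g`: it is opposite to that of `G g`.
  have hnear : ∀ᶠ y in 𝓝[<] τ, 0 < G * g * (y - τ) ^ 1 * β y ∧ ∀ z ∈ F, z < y := by
    refine ((eventually_pos_of_tendsto_div_pow (mul_ne_zero hG0 hg0) ?_).filter_mono
      (nhdsWithin_mono _ fun x hx => ne_of_lt hx)).and ?_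
    · refine (hasDerivAt_iff_tendsto_slope.1 (hu.hasDerivAt_detCols_self τ)).congr fun x => ?_
      have : detCols (u 0 0 τ) (u 1 0 τ) (u 2 0 τ) (u 3 0 τ) = 0 := hβτ
      rw [slope_def_field, this, sub_zero, pow_one]
    · rw [eventually_all_finset]
      exact fun z hz => nhdsWithin_le_nhds (lt_mem_nhds ((hmem z).1 hz).1)
  obtain ⟨y, ⟨hy, hyF⟩, hyτ⟩ := (hnear.and self_mem_nhdsWithin).exists
  have hyτ : y < τ := hyτ
  have hpar := sign_of_orders (F := F)
    (d := fun z => sigPos (w.crossingForm u τ z) + sigNeg (w.crossingForm u τ z))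
    (hu.continuous_detCols_unstable τ)
    (fun z hz => by
      obtain ⟨h1, h2⟩ := (hmem z).1 hz
      obtain ⟨L, hL, h⟩ := hu.exists_tendsto_at_crossing h2 (hreg z h1.le h2)
      exact ⟨L, eventually_pos_of_tendsto_div_pow hL h⟩)
    (hu.eventually_detCols_pos hτ) (y := y)
    (fun z hz h0 => by
      have h1 : z ∈ F := (hmem z).2 ⟨by linarith, (hu.isCrossing_iff τ z).2 h0⟩
      exact ⟨h1, hyF z h1⟩)
  rw [Finset.filter_true_of_mem hyF] at hpar
  have hM : (-1 : ℝ) ^ w.maslov u τ =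
      (-1) ^ (∑ z ∈ F, (sigPos (w.crossingForm u τ z) + sigNeg (w.crossingForm u τ z))) *
        (-1) ^ sigPos (w.crossingForm u τ τ) := by
    rw [maslov, finsum_mem_eq_finite_toFinset_sum _ hfin, neg_one_zpow_finsum_sub]
  rw [hM, hu.neg_one_pow_sigPos_self hregτ, hu.sign_lazutkinTreschev z τ]
  have hb : G * g * β y < 0 := by
    rw [pow_one] at hy
    by_contra h
    have := mul_nonneg (not_lt.1 h) (sub_nonneg.2 hyτ.le)
    linarith
  set S := ∑ z ∈ F, (sigPos (w.crossingForm u τ z) + sigNeg (w.crossingForm u τ z))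
  refine neg_one_pow_mul_neg_sign ?_
  -- The count of zeros gives `(-1)^S β(y) > 0`, and `hb` gives `G g β(y) < 0`. Dividing out `β(y)²`
  -- leaves `(-1)^S G g < 0`, where the sign of `g` cancels against the endpoint term.
  have h2 : (-1 : ℝ) ^ S * β y * (G * g * β y) < 0 := mul_neg_of_pos_of_neg hpar hb
  by_contra hneg
  have := mul_nonneg (sq_nonneg (β y)) (not_lt.1 hneg)
  linarith

end TravelingWave.IsAdaptedBasis

theorem sign_neg_one_zpow_mul {n : ℤ} {a b : ℝ} (h : (-1 : ℝ) ^ n = Real.sign a) :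
    Real.sign (a * b) = (-1) ^ n * Real.sign b := by
  rw [h]
  rcases lt_trichotomy a 0 with ha | ha | ha <;> rcases lt_trichotomy b 0 with hb | hb | hb <;>
    simp [ha, hb, Real.sign_of_pos, Real.sign_of_neg, mul_pos_of_neg_of_neg, mul_neg_of_neg_of_pos,
      mul_neg_of_pos_of_neg]

end

theorem mainTheorem1 (P : ActivatorInhibitorSystem) (w : TravelingWave P)
    (δ : ℝ) (u : Fin 4 → ℝ → ℝ → Phase) (η : Fin 4 → ℝ → Phase)
    (hu : w.IsAdaptedBasis δ u η) (τ : ℝ)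
    (hτ : ∀ τ' ≥ τ, w.unstableSubspace ⊓ stableBundle u 0 τ' = ⊥)
    (hreg : ∀ z ≤ τ, TravelingWave.IsCrossing u τ z → w.IsRegular u τ z) :
    {z | z ≤ τ ∧ TravelingWave.IsCrossing u τ z}.Finite ∧
    (∀ z, (-1 : ℝ) ^ w.maslov u τ = Real.sign (w.lazutkinTreschev u z)) ∧
    Integrable w.waveDensity ∧
    (∀ z, HasDerivAt (w.evans u z) (w.lazutkinTreschev u z * ∫ t, w.waveDensity t) 0 ∧
      Real.sign (deriv (w.evans u z) 0) =
        (-1 : ℝ) ^ w.maslov u τ * Real.sign (∫ t, w.waveDensity t)) := by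
  refine ⟨hu.finite_crossings hτ hreg, hu.neg_one_zpow_maslov hτ hreg, hu.integrable_waveDensity,
    fun z => ⟨hu.hasDerivAt_evans z, ?_⟩⟩
  rw [(hu.hasDerivAt_evans z).deriv]
  exact sign_neg_one_zpow_mul (hu.neg_one_zpow_maslov hτ hreg z)
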